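/- Let $f\in\mathbb R(x)$ be a real rational function that is not of the form $f(x)=ax+b$. For every real $t$ at which $f$ has no pole, the local focus of $f$ at $t$ is the point $$\bigl(1 : f(t)-t f'(t) : 1-f'(t)\bigr)\in\mathbb P^2(\mathbb R),$$ that is, under the embedding $(x,y)\mapsto(x:y:1)$, the point $\Bigl(\frac{1}{1-f'(t)},\frac{f(t)-tf'(t)}{1-f'(t)}\Bigr)$ of the plane if $f'(t)\neq1$, and a point at infinity if $f'(t)=1$. The focal curve of $f$ is the set of all its local foci. Say that a set $S\subset\mathbb P^2(\mathbb R)$ is an algebraic plane curve with minimal equation $F=0$ if $F\in\mathbb R[X,Y,Z]$ is a homogeneous polynomial that is irreducible over $\mathbb C$, a real homogeneous polynomial vanishes on $S$ if and only if it is divisible by $F$, and all but finitely many real zeros of $F$ in $\mathbb P^2(\mathbb R)$ belong to $S$ (so $S$ is the real curve $F=0$ up to finitely many missing points); its degree is $\deg F$. Then the graph $\{(t:f(t):1)\}$ of $f$ is an algebraic plane curve with some minimal equation $G=0$; let $C\subset\mathbb P^2(\mathbb C)$ be the complex projective curve $G=0$. The focal curve of $f$ is also an algebraic plane curve, and its degree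 is equal to the class of $C$, i.e. to the number of distinct lines tangent to $C$ through a generic point: there is a nonzero homogeneous polynomial $H\in\mathbb C[X,Y,Z]$ such that through every $q\in\mathbb P^2(\mathbb C)$ with $H(q)\neq0$ there pass exactly $d$ lines tangent to $C$, where $d$ is the degree of the focal curve. Here a line is tangent to $C$ at a point $p\in C$ if it meets $C$ at $p$ with intersection multiplicity greater than the multiplicity of $C$ at $p$ (at a smooth point this is the usual tangent line, at a singular point the lines of the tangent cone). -/

import Mathlib

noncomputable section

/-- The projective plane over a field `K`, with homogeneous coordinates `(X : Y : Z)` indexed by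
`0, 1, 2`. The affine plane is embedded by `(x, y) ↦ (x : y : 1)`. -/
abbrev ProjPlane (K : Type) [Field K] : Type := Projectivization K (Fin 3 → K)

/-- The form `F` vanishes at the point `p`. This is only used for homogeneous `F`, where it does not
depend on the chosen representative of `p`. -/
def VanishesAt {K : Type} [Field K] (F : MvPolynomial (Fin 3) K) (p : ProjPlane K) : Prop :=
  MvPolynomial.eval p.rep F = 0

/-- The point `(x : y : 1)` of the projective plane. -/
def affinePoint (x y : ℝ) : ProjPlane ℝ :=
  Projectivization.mk ℝ ![x, y, 1] (fun h => one_ne_zero (congrFun h 2))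

/-- The focus `(1 : b : 1 - a)` of the linear function `x ↦ a * x + b`: the common point of the
lines through `(0, x)` and `(1, a * x + b)`. -/
def linearFocus (a b : ℝ) : ProjPlane ℝ :=
  Projectivization.mk ℝ ![1, b, 1 - a] (fun h => one_ne_zero (congrFun h 0))

/-- The local focus of `g` at `t`: the focus of the best linear approximation
`x ↦ g t + g' t * (x - t)` of `g` at `t`. -/
def localFocus (g : ℝ → ℝ) (t : ℝ) : ProjPlane ℝ :=
  linearFocus (deriv g t) (g t - t * deriv g t)

/-- If `g' t ≠ 1`, the local focus is the point of the affine plane with coordinates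
`1 / (1 - g' t)` and `(g t - t * g' t) / (1 - g' t)`. -/
theorem localFocus_eq_affinePoint (g : ℝ → ℝ) (t : ℝ) (h : deriv g t ≠ 1) :
    localFocus g t =
      affinePoint (1 / (1 - deriv g t)) ((g t - t * deriv g t) / (1 - deriv g t)) := by
  have h1 : (1 - deriv g t) ≠ 0 := sub_ne_zero.mpr h.symm
  unfold localFocus linearFocus affinePoint
  rw [Projectivization.mk_eq_mk_iff']
  refine ⟨1 - deriv g t, ?_⟩
  funext i
  fin_cases i
  · simp [h1]
  · simp [mul_div_cancel₀, h1]
  · simp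

/-- The real function given by a rational function. -/
def ratFun (f : RatFunc ℝ) (x : ℝ) : ℝ := RatFunc.eval (RingHom.id ℝ) x f

/-- The set of real numbers at which a rational function has no pole. -/
def ratDomain (f : RatFunc ℝ) : Set ℝ := {x | f.denom.eval x ≠ 0}

/-- The graph of a rational function, as a set of points of the real projective plane. -/
def graphCurve (f : RatFunc ℝ) : Set (ProjPlane ℝ) :=
  {p | ∃ t ∈ ratDomain f, p = affinePoint t (ratFun f t)}

/-- The focal curve of a rational function: the set of its local foci. -/
def focalCurve (f : RatFunc ℝ) : Set (ProjPlane ℝ) :=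
  {p | ∃ t ∈ ratDomain f, p = localFocus (ratFun f) t}

/-- `S` is (up to finitely many missing points) the set of real points of the irreducible plane
algebraic curve with minimal equation `F = 0`: the form `F` is irreducible over `ℂ`, a real form
vanishes on `S` exactly when it is a multiple of `F`, and all but finitely many real zeros of `F`
lie in `S`. The degree of the curve is the degree of `F`. -/
structure IsAlgebraicCurve (S : Set (ProjPlane ℝ)) (F : MvPolynomial (Fin 3) ℝ) : Prop where
  homogeneous : F.IsHomogeneous F.totalDegree
  irreducible : Irreducible (MvPolynomial.map (algebraMap ℝ ℂ) F)
  vanishing : ∀ (n : ℕ) (G : MvPolynomial (Fin 3) ℝ), G.IsHomogeneous n →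
    ((∀ p ∈ S, VanishesAt G p) ↔ F ∣ G)
  finite_missing : ({p : ProjPlane ℝ | VanishesAt F p} \ S).Finite

/-- The one-variable polynomial `G (p + s * v)` in `s`. Its coefficient of `s ^ n` is the
`n`-th Taylor form of `G` at `p`, evaluated at `v`. -/
def expandAt (G : MvPolynomial (Fin 3) ℂ) (p v : Fin 3 → ℂ) : Polynomial ℂ :=
  MvPolynomial.aeval (fun i => Polynomial.C (p i) + Polynomial.X * Polynomial.C (v i)) G

/-- The multiplicity of the curve `G = 0` (with `G ≠ 0`) at the point `p`: the order of the first
nonzero Taylor form of `G` at `p`. -/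
def multiplicityAt (G : MvPolynomial (Fin 3) ℂ) (p : ProjPlane ℂ) : ℕ :=
  sInf {n | ∃ v : Fin 3 → ℂ, (expandAt G p.rep v).coeff n ≠ 0}

/-- The point `p` lies on the line `A * X + B * Y + C * Z = 0`, where `l = (A : B : C)`. -/
def LiesOn (p l : ProjPlane ℂ) : Prop := l.rep ⬝ᵥ p.rep = 0

/-- The line `l` is tangent at `p` to the curve `G = 0`: both pass through `p`, and the
first nonzero Taylor form of `G` at `p` vanishes along `l`; that is, `l` meets the curve at `p`
with multiplicity greater than that of the curve at `p`. At a smooth point this is the usual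
tangent line; at a singular point the tangents are the lines of the tangent cone. -/
def IsTangentAt (G : MvPolynomial (Fin 3) ℂ) (l p : ProjPlane ℂ) : Prop :=
  VanishesAt G p ∧ LiesOn p l ∧
    ∀ v : Fin 3 → ℂ, l.rep ⬝ᵥ v = 0 → (expandAt G p.rep v).coeff (multiplicityAt G p) = 0

/-- The lines tangent to the curve `G = 0`, as points of the dual plane. -/
def tangentLines (G : MvPolynomial (Fin 3) ℂ) : Set (ProjPlane ℂ) :=
  {l | ∃ p, IsTangentAt G l p}

/-- The complex curve `G = 0` has class `d`: through a generic point `q` of the complex projective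
plane (every point outside some curve `H = 0`) there pass exactly `d` tangent lines. -/
def HasClass (G : MvPolynomial (Fin 3) ℂ) (d : ℕ) : Prop :=
  ∃ (k : ℕ) (H : MvPolynomial (Fin 3) ℂ), H ≠ 0 ∧ H.IsHomogeneous k ∧
    ∀ q : ProjPlane ℂ, ¬ VanishesAt H q → {l ∈ tangentLines G | LiesOn q l}.encard = (d : ℕ∞)

end

/-! Write f = P/Q in lowest terms and parametrize the graph by γ = (tQ : P : Q). Its tangent at
parameter t has line coordinates δ = γ × γ' (`dualCurve`). The focus of the line δ₀x + δ₁y + δ₂ = 0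
is (δ₁ : -δ₂ : δ₀ + δ₁), an invertible linear function of δ. So the focal curve is a projective
image of the dual curve and has the same degree; what remains is that the class of a curve is the
degree of its dual.

If no two coordinates of a polynomial parametrization are proportional, the kernel of X_i ↦ s γ_i(t)
is a prime ideal generated by one form (`exists_isEquation`). Splitting into real and imaginary
parts shows that a real generator still generates over ℂ (`IsEquation.map`), whence irreducibility
over ℂ.

The rest hangs on biduality (`dualCurve_dualCurve`): δ × δ' = Wγ with W = det(γ, γ', γ''), and W ≠ 0
because f is not affine (`wronskianDet_graphParam_ne_zero`). The gradient of a form vanishing on a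
curve is parallel to the dual curve, so the gradient of the dual equation E along δ is parallel to
γ. This has two consequences. The parameter t = γ₀/γ₂ is a quotient of two partial derivatives of E
along δ, so all but finitely many points of E = 0 come from good parameters
(`IsEquation.finite_diff_range`). And the pencil of lines through q, a line of the dual plane, is
transversal to E = 0 at a good δ(t) unless q = γ(t). For q off C and off finitely many further
curves, the pencil therefore meets E = 0 in exactly deg E points (`encard_line_section`), and these
are the tangents through q (`hasClass_of_isEquation_dualCurve`). -/

open Polynomial in
/-- The `n`-th coefficient of `F (s * v)`, as a polynomial in `s`, is the value at `v` of the
homogeneous component of degree `n` of `F`. -/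
theorem coeff_aeval_X_mul_C {σ k A : Type*} [CommRing k] [CommRing A] [Algebra k A]
    (v : σ → A) (F : MvPolynomial σ k) (n : ℕ) :
    (MvPolynomial.aeval (fun i => (X : A[X]) * C (v i)) F).coeff n =
      MvPolynomial.aeval v (MvPolynomial.homogeneousComponent n F) := by
  induction F using MvPolynomial.induction_on' with
  | monomial m a =>
    have h1 : MvPolynomial.aeval (fun i => (X : A[X]) * C (v i)) (MvPolynomial.monomial m a) =
        C (MvPolynomial.aeval v (MvPolynomial.monomial m a)) * X ^ m.degree := by
      simp only [MvPolynomial.aeval_monomial, Finsupp.prod, mul_pow, Finset.prod_mul_distrib,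
        Finset.prod_pow_eq_pow_sum, map_mul, map_prod, map_pow, Finsupp.degree_apply,
        Polynomial.algebraMap_apply]
      ring
    rw [h1, coeff_C_mul_X_pow]
    split_ifs with h
    · rw [MvPolynomial.homogeneousComponent_eq_self]
      exact MvPolynomial.isHomogeneous_monomial _ h.symm
    · rw [MvPolynomial.homogeneousComponent_of_mem
        (MvPolynomial.isHomogeneous_monomial (n := m.degree) a rfl), if_neg h, map_zero]
  | add p q hp hq => simp only [map_add, coeff_add, hp, hq]

open Polynomial in
/-- The chain rule for substituting univariate polynomials into a multivariate one. -/
theorem derivative_aeval {σ k A : Type*} [Fintype σ] [CommRing k] [CommRing A] [Algebra k A]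
    (g : σ → A[X]) (F : MvPolynomial σ k) :
    derivative (MvPolynomial.aeval g F) =
      ∑ i, MvPolynomial.aeval g (MvPolynomial.pderiv i F) * derivative (g i) := by
  classical
  induction F using MvPolynomial.induction_on with
  | C a => simp [Polynomial.algebraMap_apply]
  | add p q hp hq => simp only [map_add, hp, hq, add_mul, Finset.sum_add_distrib]
  | mul_X p j hp =>
    simp only [map_mul, derivative_mul, hp, MvPolynomial.aeval_X, Derivation.leibniz, map_add,
      smul_eq_mul, MvPolynomial.pderiv_X, add_mul, Finset.sum_add_distrib]
    rw [add_comm]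
    congr 1
    · rw [Finset.sum_eq_single j]
      · simp
      · intro b _ hb
        simp [hb.symm]
      · simp
    · rw [Finset.sum_mul]
      exact Finset.sum_congr rfl fun i _ => by ring

/-! ### Jacobian criterion for binary forms -/

section EqOfZero
open Polynomial

variable {k : Type*} [Field k] [CharZero k]

/-- Jacobian criterion for binary forms: if the Wronskian of `a` and `b` is nonzero, no nonzero
binary form vanishes at `(a, b)`. -/
theorem eq_zero_of_aeval_eq_zero_of_isHomogeneous {a b : k[X]} (hw : wronskian a b ≠ 0) (n : ℕ) :
    ∀ r : MvPolynomial (Fin 2) k, r.IsHomogeneous n → MvPolynomial.aeval ![a, b] r = 0 → r = 0 := by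
  induction n with
  | zero =>
    intro r hr h0
    rw [← MvPolynomial.totalDegree_zero_iff_isHomogeneous,
      MvPolynomial.totalDegree_eq_zero_iff_eq_C] at hr
    rw [hr] at h0 ⊢
    simpa using h0
  | succ n ih =>
    intro r hr h0
    -- The chain rule and Euler's relation are two linear equations for the partials of `r` at (a,
    -- b), with determinant the Wronskian up to sign. Both partials therefore vanish there, and
    -- induction applies to them.
    have h1 := derivative_aeval ![a, b] r
    have h2 := congrArg (MvPolynomial.aeval ![a, b]) hr.sum_X_mul_pderiv
    rw [h0] at h1
    simp only [Fin.sum_univ_two, map_add, map_mul, MvPolynomial.aeval_X, map_nsmul, h0, smul_zero,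
      Matrix.cons_val_zero, Matrix.cons_val_one, derivative_zero] at h1 h2
    set p := MvPolynomial.aeval ![a, b] (MvPolynomial.pderiv 0 r)
    set q := MvPolynomial.aeval ![a, b] (MvPolynomial.pderiv 1 r)
    have hp : p = 0 := by
      have : p * wronskian a b = 0 := by
        rw [wronskian]; linear_combination derivative b * h2 + b * h1
      exact (mul_eq_zero.mp this).resolve_right hw
    have hq : q = 0 := by
      have : q * wronskian a b = 0 := by
        rw [wronskian]; linear_combination -derivative a * h2 - a * h1
      exact (mul_eq_zero.mp this).resolve_right hw
    have e0 := ih _ (by simpa using hr.pderiv (i := 0)) hp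
    have e1 := ih _ (by simpa using hr.pderiv (i := 1)) hq
    have h3 := hr.sum_X_mul_pderiv
    rw [Fin.sum_univ_two, e0, e1] at h3
    have h4 : (n : MvPolynomial (Fin 2) k) + 1 ≠ 0 := by exact_mod_cast n.succ_ne_zero
    simpa [h4] using h3.symm

end EqOfZero

/-! ### Elimination of one variable modulo a prime polynomial -/

section Elimination

open MvPolynomial

variable {k : Type*} [Field k]

/-- In a domain of transcendence degree at most two, every nonzero element divides a nonzero
polynomial in two given algebraically independent elements. -/
theorem exists_dvd_aeval_of_trdeg_le_two {D : Type*} [CommRing D] [IsDomain D] [Algebra k D]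
    (hD : Algebra.trdeg k D ≤ 2) {x : Fin 2 → D} (hx : AlgebraicIndependent k x) {c : D}
    (hc : c ≠ 0) : ∃ r : MvPolynomial (Fin 2) k, r ≠ 0 ∧ c ∣ aeval x r := by
  have hb : IsTranscendenceBasis k x :=
    hx.isTranscendenceBasis_of_lift_trdeg_le_of_finite (by simpa using hD)
  have := hb.isAlgebraic
  -- `c` is algebraic over k[x₀, x₁] and nonzero, so it divides the nonzero constant term of some
  -- algebraic relation.
  obtain ⟨r, hr, hd⟩ := (Algebra.IsAlgebraic.isAlgebraic (R := Algebra.adjoin k (Set.range x))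
    c).exists_nonzero_dvd (mem_nonZeroDivisors_of_ne_zero hc)
  obtain ⟨r, hr'⟩ := r
  have hr2 := hr'
  rw [Algebra.adjoin_range_eq_range_aeval] at hr2
  obtain ⟨s, rfl⟩ := hr2
  refine ⟨s, ?_, hd⟩
  rintro rfl
  exact hr (Subtype.ext (map_zero (aeval x)))

/-- A domain generated by three algebraically dependent elements has transcendence degree at
most two. -/
theorem trdeg_le_two_of_surjective {D : Type*} [CommRing D] [IsDomain D] [Algebra k D]
    {φ : MvPolynomial (Fin 3) k →ₐ[k] D} (hφ : Function.Surjective φ)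
    {F : MvPolynomial (Fin 3) k} (hF : F ≠ 0) (h0 : φ F = 0) : Algebra.trdeg k D ≤ 2 := by
  have hr : φ = aeval fun i => φ (X i) := by ext; simp
  have hx : Algebra.adjoin k (Set.range fun i => φ (X i)) = ⊤ := by
    rw [Algebra.adjoin_range_eq_range_aeval, ← hr, AlgHom.range_eq_top]
    exact hφ
  by_contra! h
  have h3 : ((3 : ℕ) : Cardinal) ≤ Algebra.trdeg k D := by
    have := Order.succ_le_of_lt h
    rw [show (2 : Cardinal) = ((2 : ℕ) : Cardinal) from rfl, Cardinal.succ_natCast] at this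
    exact_mod_cast this
  have : Algebra.IsAlgebraic (Algebra.adjoin k (Set.range fun i => φ (X i))) D := by
    rw [hx]
    exact ⟨fun y => isAlgebraic_algebraMap (A := D) (⟨y, trivial⟩ : (⊤ : Subalgebra k D))⟩
  have hb := Algebra.IsAlgebraic.isTranscendenceBasis_of_lift_le_trdeg_of_finite k
    (fun i => φ (X i)) (by simpa using h3)
  have h1 := hb.1
  rw [algebraicIndependent_iff] at h1
  exact hF (h1 F (by rw [← hr, h0]))

/-- Elimination: if `F` is prime, `K` is not a multiple of `F` and the variables `i`, `j` are
algebraically independent modulo `F`, then the ideal of `F` and `K` contains a nonzero polynomial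
in these two variables. -/
theorem exists_rename_eq_of_not_dvd {F K : MvPolynomial (Fin 3) k} (hF : Prime F)
    {e : Fin 2 → Fin 3} (he : ∀ r : MvPolynomial (Fin 2) k, F ∣ rename e r → r = 0)
    (hK : ¬ F ∣ K) : ∃ r : MvPolynomial (Fin 2) k, r ≠ 0 ∧ ∃ A B, rename e r = A * F + B * K := by
  have hpr : (Ideal.span {F}).IsPrime := (Ideal.span_singleton_prime hF.ne_zero).mpr hF
  set φ := Ideal.Quotient.mkₐ k (Ideal.span {F})
  have hφ : ∀ G, φ G = 0 ↔ F ∣ G := fun G =>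
    Ideal.Quotient.eq_zero_iff_mem.trans Ideal.mem_span_singleton
  have hcomp : ∀ r, aeval (fun i => φ (X (e i))) r = φ (rename e r) := by
    intro r
    have : aeval (fun i => φ (X (e i))) = φ.comp (rename e) := by ext; simp
    rw [this]; rfl
  obtain ⟨r, hr, hd⟩ := exists_dvd_aeval_of_trdeg_le_two 
    (trdeg_le_two_of_surjective (Ideal.Quotient.mkₐ_surjective k (Ideal.span {F})) hF.ne_zero
      ((hφ F).mpr dvd_rfl))
    (x := fun i => φ (X (e i))) (c := φ K) (by
      rw [algebraicIndependent_iff]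
      intro r h
      rw [hcomp, hφ] at h
      exact he r h) (by rwa [Ne, hφ])
  refine ⟨r, hr, ?_⟩
  obtain ⟨c, hc⟩ := hd
  obtain ⟨B, rfl⟩ := Ideal.Quotient.mkₐ_surjective k (Ideal.span {F}) c
  rw [hcomp] at hc
  have : φ (rename e r - K * B) = 0 := by rw [map_sub, map_mul, hc, sub_self]
  obtain ⟨A, hA⟩ := (hφ _).mp this
  exact ⟨A, B, by linear_combination hA⟩

end Elimination

noncomputable section

/-! ### The homogeneous ideal of a parametrized plane curve -/

section CurveEquation

open Polynomial

variable {k : Type} [Field k]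

/-- The map from forms to polynomial functions on the cone over the curve parametrized by `γ`. -/
def coneMap (γ : Fin 3 → k[X]) : MvPolynomial (Fin 3) k →ₐ[k] k[X][X] :=
  MvPolynomial.aeval fun i => X * C (γ i)

/-- `F` is a homogeneous generator of the ideal of the plane curve parametrized by `γ`. -/
structure IsEquation (γ : Fin 3 → k[X]) (F : MvPolynomial (Fin 3) k) : Prop where
  homogeneous : F.IsHomogeneous F.totalDegree
  ne_zero : F ≠ 0
  coneMap_eq_zero_iff : ∀ G, coneMap γ G = 0 ↔ F ∣ G

theorem coneMap_eq_zero_iff_forall (γ : Fin 3 → k[X]) (G : MvPolynomial (Fin 3) k) :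
    coneMap γ G = 0 ↔ ∀ n, MvPolynomial.aeval γ (MvPolynomial.homogeneousComponent n G) = 0 := by
  rw [Polynomial.ext_iff]
  simp only [coneMap, coeff_aeval_X_mul_C, coeff_zero]

theorem coneMap_eq_zero_iff_of_isHomogeneous (γ : Fin 3 → k[X]) {G : MvPolynomial (Fin 3) k} {n : ℕ}
    (hG : G.IsHomogeneous n) : coneMap γ G = 0 ↔ MvPolynomial.aeval γ G = 0 := by
  rw [coneMap_eq_zero_iff_forall]
  refine ⟨fun h => ?_, fun h m => ?_⟩
  · have := h n
    rwa [MvPolynomial.homogeneousComponent_eq_self hG] at this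
  · rw [MvPolynomial.homogeneousComponent_of_mem hG]
    split_ifs
    · exact h
    · exact map_zero _

theorem IsEquation.dvd_iff {γ : Fin 3 → k[X]} {F : MvPolynomial (Fin 3) k} (hF : IsEquation γ F)
    {G : MvPolynomial (Fin 3) k} {n : ℕ} (hG : G.IsHomogeneous n) :
    F ∣ G ↔ MvPolynomial.aeval γ G = 0 := by
  rw [← hF.coneMap_eq_zero_iff, coneMap_eq_zero_iff_of_isHomogeneous γ hG]

theorem IsEquation.aeval_eq_zero {γ : Fin 3 → k[X]} {F : MvPolynomial (Fin 3) k}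
    (hF : IsEquation γ F) : MvPolynomial.aeval γ F = 0 :=
  (hF.dvd_iff hF.homogeneous).mp dvd_rfl

theorem IsEquation.prime {γ : Fin 3 → k[X]} {F : MvPolynomial (Fin 3) k} (hF : IsEquation γ F) :
    Prime F := by
  refine ⟨hF.ne_zero, fun h => ?_, fun a b h => ?_⟩
  · have := (hF.coneMap_eq_zero_iff 1).mpr h.dvd
    rw [map_one] at this
    exact one_ne_zero this
  · rw [← hF.coneMap_eq_zero_iff, map_mul, mul_eq_zero] at h
    rwa [hF.coneMap_eq_zero_iff, hF.coneMap_eq_zero_iff] at h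

/-- The target k[t][s] has transcendence degree two, so three elements of it are algebraically
dependent. -/
theorem exists_ne_zero_coneMap_eq_zero (γ : Fin 3 → k[X]) : ∃ G, G ≠ 0 ∧ coneMap γ G = 0 := by
  by_contra! h
  have hi : AlgebraicIndependent k (fun i => X * C (γ i)) := by
    rw [algebraicIndependent_iff]
    intro p hp
    by_contra h0
    exact h p h0 hp
  have h1 := hi.lift_cardinalMk_le_trdeg
  rw [← trdeg_add_eq k k[X], Polynomial.trdeg_of_isDomain,
    Polynomial.trdeg_of_isDomain] at h1
  simp only [Cardinal.mk_fin, Cardinal.lift_id] at h1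
  have h2 : 3 ≤ 1 + 1 := by exact_mod_cast h1
  omega

variable [CharZero k]

/-- Powers of the cone variable separate the homogeneous components, and the Jacobian criterion
kills each of them. This is the independence of two coordinates that elimination requires. -/
theorem eq_zero_of_coneMap_rename_eq_zero {γ : Fin 3 → k[X]} {e : Fin 2 → Fin 3}
    (hw : wronskian (γ (e 0)) (γ (e 1)) ≠ 0) {r : MvPolynomial (Fin 2) k}
    (h : coneMap γ (MvPolynomial.rename e r) = 0) : r = 0 := by
  have he : (fun i => γ (e i)) = ![γ (e 0), γ (e 1)] := by
    funext i; fin_cases i <;> rfl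
  rw [coneMap, MvPolynomial.aeval_rename] at h
  rw [← MvPolynomial.sum_homogeneousComponent r]
  refine Finset.sum_eq_zero fun n _ => ?_
  refine eq_zero_of_aeval_eq_zero_of_isHomogeneous hw n _
    (MvPolynomial.homogeneousComponent_isHomogeneous n r) ?_
  rw [← he, ← coeff_aeval_X_mul_C]
  exact (congrArg (fun p => Polynomial.coeff p n) h).trans (coeff_zero n)

/-- A plane curve parametrized by polynomials, no two of which are proportional, has an
equation. -/
theorem exists_isEquation {γ : Fin 3 → k[X]} (hw : ∀ i j, i ≠ j → wronskian (γ i) (γ j) ≠ 0) :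
    ∃ F, IsEquation γ F := by
  obtain ⟨G, hG0, hG⟩ := exists_ne_zero_coneMap_eq_zero γ
  obtain ⟨F, hF, hFG⟩ : ∃ F, Irreducible F ∧ coneMap γ F = 0 := by
    revert hG
    induction G using WfDvdMonoid.induction_on_irreducible with
    | zero => exact absurd rfl hG0
    | unit u hu => exact fun h => absurd h (hu.map (coneMap γ)).ne_zero
    | mul a i ha hi ih =>
      intro h
      rw [map_mul, mul_eq_zero] at h
      exact h.elim (fun h => ⟨i, hi, h⟩) (ih ha)
  -- A kernel element not divisible by `F` would, by elimination, put a nonzero polynomial in the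
  -- first two variables into the kernel.
  have hgen : ∀ G, coneMap γ G = 0 ↔ F ∣ G := by
    intro G
    refine ⟨fun h => ?_, fun ⟨c, hc⟩ => by rw [hc, map_mul, hFG, zero_mul]⟩
    by_contra hd
    obtain ⟨r, hr, A, B, hAB⟩ := exists_rename_eq_of_not_dvd (e := ![0, 1]) hF.prime
      (fun r ⟨c, hc⟩ => eq_zero_of_coneMap_rename_eq_zero (γ := γ) (e := ![0, 1])
        (hw 0 1 (by decide)) (by rw [hc, map_mul, hFG, zero_mul])) hd
    refine hr (eq_zero_of_coneMap_rename_eq_zero (γ := γ) (e := ![0, 1])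
        (hw 0 1 (by decide)) ?_)
    rw [hAB, map_add, map_mul, map_mul, hFG, h, mul_zero, mul_zero, add_zero]
  -- The kernel is homogeneous, so `F` divides each of its own components; a nonzero one of lower
  -- degree is too small for that.
  have hcomp : ∀ n, n ≠ F.totalDegree → MvPolynomial.homogeneousComponent n F = 0 := by
    intro n hn
    by_contra h0
    have hd : F ∣ MvPolynomial.homogeneousComponent n F := by
      rw [← hgen, coneMap_eq_zero_iff_of_isHomogeneous γ
        (MvPolynomial.homogeneousComponent_isHomogeneous n F)]
      exact (coneMap_eq_zero_iff_forall γ F).mp hFG n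
    have h1 := MvPolynomial.totalDegree_le_of_dvd_of_isDomain hd h0
    rw [(MvPolynomial.homogeneousComponent_isHomogeneous n F).totalDegree h0] at h1
    exact h0 (MvPolynomial.homogeneousComponent_eq_zero _ _ (lt_of_le_of_ne h1 hn.symm))
  refine ⟨F, ?_, hF.ne_zero, hgen⟩
  have hs := MvPolynomial.sum_homogeneousComponent F
  rw [Finset.sum_eq_single F.totalDegree (fun n _ hn => hcomp n hn) (by simp)] at hs
  have := MvPolynomial.homogeneousComponent_isHomogeneous F.totalDegree F
  rwa [hs] at this

end CurveEquation

/-! ### Passage from real to complex equations -/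

section BaseChange

open Polynomial

theorem exists_map_add_I_mul_map {σ : Type*} (G : MvPolynomial σ ℂ) :
    ∃ A B : MvPolynomial σ ℝ, G = MvPolynomial.map (algebraMap ℝ ℂ) A +
      MvPolynomial.C Complex.I * MvPolynomial.map (algebraMap ℝ ℂ) B := by
  induction G using MvPolynomial.induction_on with
  | C a =>
    refine ⟨MvPolynomial.C a.re, MvPolynomial.C a.im, ?_⟩
    rw [MvPolynomial.map_C, MvPolynomial.map_C, ← map_mul, ← map_add]
    congr 1
    rw [mul_comm]
    exact (Complex.re_add_im a).symm
  | add p q hp hq =>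
    obtain ⟨A, B, rfl⟩ := hp
    obtain ⟨A', B', rfl⟩ := hq
    exact ⟨A + A', B + B', by simp only [map_add]; ring⟩
  | mul_X p i hp =>
    obtain ⟨A, B, rfl⟩ := hp
    exact ⟨A * MvPolynomial.X i, B * MvPolynomial.X i, by
      simp only [map_mul, MvPolynomial.map_X]; ring⟩

theorem eq_zero_of_map_add_I_mul_map {u v : ℝ[X][X]}
    (h : u.map (mapRingHom (algebraMap ℝ ℂ)) +
      C (C Complex.I) * v.map (mapRingHom (algebraMap ℝ ℂ)) = 0) : u = 0 ∧ v = 0 := by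
  have key : ∀ m n, (u.coeff m).coeff n = 0 ∧ (v.coeff m).coeff n = 0 := by
    intro m n
    have h1 := congrArg (fun p => (p.coeff m).coeff n) h
    simp only [coeff_add, coeff_map, coeff_C_mul, coe_mapRingHom, coeff_zero] at h1
    have h2 := Complex.ext_iff.mp h1
    simpa using h2
  exact ⟨by ext m n; simp [(key m n).1], by ext m n; simp [(key m n).2]⟩

theorem coneMap_map (γ : Fin 3 → ℝ[X]) (G : MvPolynomial (Fin 3) ℝ) :
    coneMap (fun i => (γ i).map (algebraMap ℝ ℂ)) (MvPolynomial.map (algebraMap ℝ ℂ) G) =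
      (coneMap γ G).map (mapRingHom (algebraMap ℝ ℂ)) := by
  induction G using MvPolynomial.induction_on with
  | C a => simp [coneMap, Polynomial.algebraMap_apply]
  | add p q hp hq => simp only [map_add, hp, hq, Polynomial.map_add]
  | mul_X p i hp =>
    simp only [map_mul, hp, Polynomial.map_mul, MvPolynomial.map_X]
    simp [coneMap]

/-- The equation of a real parametrized curve is also the equation of its complexification. -/
theorem IsEquation.map {γ : Fin 3 → ℝ[X]} {F : MvPolynomial (Fin 3) ℝ} (hF : IsEquation γ F) :
    IsEquation (fun i => (γ i).map (algebraMap ℝ ℂ)) (MvPolynomial.map (algebraMap ℝ ℂ) F) := by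
  have hne : MvPolynomial.map (algebraMap ℝ ℂ) F ≠ 0 := by
    exact (map_ne_zero_iff _ (MvPolynomial.map_injective _ (algebraMap ℝ ℂ).injective)).mpr
      hF.ne_zero
  have hh := hF.homogeneous.map (algebraMap ℝ ℂ)
  refine ⟨by rwa [hh.totalDegree hne], hne, fun G => ⟨fun h => ?_, ?_⟩⟩
  · obtain ⟨A, B, rfl⟩ := exists_map_add_I_mul_map G
    rw [map_add, map_mul, coneMap_map, coneMap_map] at h
    have hI : coneMap (fun i => (γ i).map (algebraMap ℝ ℂ)) (MvPolynomial.C Complex.I) =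
        C (C Complex.I) := by
      simp [coneMap, Polynomial.algebraMap_apply]
    rw [hI] at h
    obtain ⟨hA, hB⟩ := eq_zero_of_map_add_I_mul_map h
    rw [hF.coneMap_eq_zero_iff] at hA hB
    exact dvd_add (map_dvd _ hA) (dvd_mul_of_dvd_right (map_dvd _ hB) _)
  · rintro ⟨c, rfl⟩
    rw [map_mul, coneMap_map, (hF.coneMap_eq_zero_iff F).mpr dvd_rfl, Polynomial.map_zero, zero_mul]

end BaseChange

end

noncomputable section

/-! ### Finiteness criterion for sets of projective points -/

section ProjectivePoints

open Polynomial

variable {k : Type} [Field k]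

theorem MvPolynomial.IsHomogeneous.eval_smul {σ R : Type*} [CommRing R] {F : MvPolynomial σ R}
    {n : ℕ} (hF : F.IsHomogeneous n) (c : R) (v : σ → R) :
    MvPolynomial.eval (c • v) F = c ^ n * MvPolynomial.eval v F := by
  rw [MvPolynomial.eval_eq, MvPolynomial.eval_eq, Finset.mul_sum]
  refine Finset.sum_congr rfl fun d hd => ?_
  rw [hF.degree_eq_sum_deg_support hd]
  simp only [Pi.smul_apply, smul_eq_mul, mul_pow, Finset.prod_mul_distrib,
    Finset.prod_pow_eq_pow_sum]
  ring

theorem MvPolynomial.IsHomogeneous.eval_smul_eq_zero_iff {σ R : Type*} [CommRing R] [IsDomain R]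
    {F : MvPolynomial σ R} {n : ℕ} (hF : F.IsHomogeneous n) {c : R} (hc : c ≠ 0) (v : σ → R) :
    MvPolynomial.eval (c • v) F = 0 ↔ MvPolynomial.eval v F = 0 := by
  rw [hF.eval_smul, mul_eq_zero, or_iff_right (pow_ne_zero n hc)]

theorem vanishesAt_mk {F : MvPolynomial (Fin 3) k} {n : ℕ} (hF : F.IsHomogeneous n)
    (v : Fin 3 → k) (hv : v ≠ 0) :
    VanishesAt F (Projectivization.mk k v hv) ↔ MvPolynomial.eval v F = 0 := by
  obtain ⟨a, ha⟩ := Projectivization.exists_smul_eq_mk_rep k v hv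
  rw [VanishesAt, ← ha, Units.smul_def, hF.eval_smul_eq_zero_iff a.ne_zero]

/-- Fix a point a with a₀ ≠ 0 and r(a) ≠ 0. Then r(a₀, a₀y) is a polynomial in y that does not
vanish at a₁/a₀, and its roots form the finite set. All scalings c occur in the condition because
`r` need not be homogeneous. -/
theorem exists_finset_of_binary [Infinite k] {r : MvPolynomial (Fin 2) k} (hr : r ≠ 0) :
    ∃ T : Finset k, ∀ y : k, (∀ c : k, c ≠ 0 → MvPolynomial.eval ![c, c * y] r = 0) → y ∈ T := by
  obtain ⟨a, ha⟩ : ∃ a, MvPolynomial.eval a (MvPolynomial.X 0 * r) ≠ 0 := by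
    by_contra! h
    exact mul_ne_zero (MvPolynomial.X_ne_zero 0) hr (MvPolynomial.funext fun x => by simp [h x])
  rw [map_mul, MvPolynomial.eval_X] at ha
  have ha0 := left_ne_zero_of_mul ha
  set ρ : k[X] := MvPolynomial.aeval ![C (a 0), C (a 0) * X] r with hρ
  have heval : ∀ y, ρ.eval y = MvPolynomial.eval ![a 0, a 0 * y] r := by
    intro y
    rw [hρ, ← Polynomial.coe_aeval_eq_eval, ← AlgHom.comp_apply, MvPolynomial.comp_aeval,
      ← MvPolynomial.aeval_eq_eval]
    congr 2
    funext i
    fin_cases i <;> simp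
  have hρ0 : ρ ≠ 0 := by
    intro h
    have h1 := heval (a 1 / a 0)
    rw [h, eval_zero, mul_div_cancel₀ _ ha0] at h1
    refine right_ne_zero_of_mul ha ?_
    rw [h1]
    congr 2
    funext i
    fin_cases i <;> rfl
  classical
  exact ⟨ρ.roots.toFinset, fun y hy => by
    rw [Multiset.mem_toFinset, mem_roots hρ0, IsRoot.def, heval]
    exact hy _ ha0⟩

/-- A set of points of the projective plane is finite if any two homogeneous coordinates satisfy a
nontrivial polynomial relation on it. -/
theorem finite_of_binary_relations [Infinite k] {S : Set (ProjPlane k)}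
    (h : ∀ i j : Fin 3, i ≠ j → ∃ r : MvPolynomial (Fin 2) k, r ≠ 0 ∧
      ∀ v : Fin 3 → k, ∀ hv : v ≠ 0, Projectivization.mk k v hv ∈ S →
        MvPolynomial.eval ![v i, v j] r = 0) : S.Finite := by
  have hS : S = ⋃ i, {p ∈ S | p.rep i ≠ 0} := by
    ext p
    simp only [Set.mem_iUnion, Set.mem_ofPred_eq]
    refine ⟨fun hp => ?_, fun ⟨_, hp, _⟩ => hp⟩
    by_contra! h0
    exact p.rep_nonzero (funext fun i => h0 i hp)
  rw [hS]
  refine Set.finite_iUnion fun i => ?_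
  have hT : ∀ j, ∃ T : Finset k, ∀ p ∈ S, p.rep i ≠ 0 → p.rep j / p.rep i ∈ T := by
    intro j
    by_cases hij : i = j
    · subst hij
      exact ⟨{1}, fun p _ h0 => by rw [div_self h0]; exact Finset.mem_singleton_self 1⟩
    · obtain ⟨r, hr, hv⟩ := h i j hij
      obtain ⟨T, hT⟩ := exists_finset_of_binary hr
      refine ⟨T, fun p hp h0 => hT _ fun c hc => ?_⟩
      have hc' : c / p.rep i ≠ 0 := div_ne_zero hc h0
      have h1 := hv ((c / p.rep i) • p.rep) (smul_ne_zero hc' p.rep_nonzero) (by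
        convert hp
        conv_rhs => rw [← Projectivization.mk_rep p]
        exact (Projectivization.mk_eq_mk_iff' k _ _ _ _).mpr ⟨c / p.rep i, rfl⟩)
      convert h1 using 3
      funext m
      fin_cases m
      · simp [h0]
      · simp; ring
  choose T hT using hT
  refine Set.Finite.of_finite_image (f := fun p j => p.rep j / p.rep i)
    ((Set.Finite.pi' fun j => (T j).finite_toSet).subset ?_) ?_
  · rintro _ ⟨p, ⟨hp, h0⟩, rfl⟩ j
    exact hT j p hp h0
  · rintro p ⟨_, h0⟩ q ⟨_, h1⟩ hpq
    rw [← Projectivization.mk_rep p, ← Projectivization.mk_rep q, Projectivization.mk_eq_mk_iff']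
    refine ⟨p.rep i / q.rep i, funext fun j => ?_⟩
    have := congrFun hpq j
    simp only at this
    rw [div_eq_div_iff h0 h1] at this
    simp only [Pi.smul_apply, smul_eq_mul]
    field_simp
    linear_combination -this

end ProjectivePoints

/-! ### Points of a curve reached by its parametrization -/

section CurvePoints

open Polynomial

variable {k : Type} [Field k]

/-- A form not vanishing identically on a parametrized curve has finitely many zeros on it. -/
theorem IsEquation.finite_common_zeros [CharZero k] {γ : Fin 3 → k[X]} {F : MvPolynomial (Fin 3) k}
    (hF : IsEquation γ F) (hw : ∀ i j, i ≠ j → wronskian (γ i) (γ j) ≠ 0)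
    {K : MvPolynomial (Fin 3) k} {n : ℕ} (hK : K.IsHomogeneous n)
    (hK0 : MvPolynomial.aeval γ K ≠ 0) :
    {p : ProjPlane k | VanishesAt F p ∧ VanishesAt K p}.Finite := by
  refine finite_of_binary_relations fun i j hij => ?_
  obtain ⟨r, hr, A, B, hAB⟩ := exists_rename_eq_of_not_dvd (e := ![i, j]) (K := K) hF.prime
    (fun r hd => eq_zero_of_coneMap_rename_eq_zero (γ := γ) (e := ![i, j])
      (hw i j hij) ((hF.coneMap_eq_zero_iff _).mpr hd)) (by rwa [hF.dvd_iff hK])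
  refine ⟨r, hr, fun v hv ⟨h1, h2⟩ => ?_⟩
  rw [vanishesAt_mk hF.homogeneous] at h1
  rw [vanishesAt_mk hK] at h2
  have h3 := congrArg (MvPolynomial.eval v) hAB
  rw [map_add, map_mul, map_mul, h1, h2, mul_zero, mul_zero, add_zero,
    MvPolynomial.eval_rename] at h3
  rw [← h3]
  congr 2
  funext m
  fin_cases m <;> rfl

/-- The homogenization `B ^ N * g (A / B)` of a univariate polynomial `g` of degree at most `N`. -/
def homogenizeAt (g : k[X]) (N : ℕ) (A B : MvPolynomial (Fin 3) k) : MvPolynomial (Fin 3) k :=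
  ∑ i ∈ Finset.range (N + 1), MvPolynomial.C (g.coeff i) * (A ^ i * B ^ (N - i))

theorem homogenizeAt_isHomogeneous (g : k[X]) (N : ℕ) {A B : MvPolynomial (Fin 3) k} {e : ℕ}
    (hA : A.IsHomogeneous e) (hB : B.IsHomogeneous e) :
    (homogenizeAt g N A B).IsHomogeneous (e * N) := by
  refine MvPolynomial.IsHomogeneous.sum _ _ _ fun i hi => ?_
  have : e * N = 0 + (e * i + e * (N - i)) := by
    rw [zero_add, ← mul_add, Nat.add_sub_cancel' (Nat.lt_succ_iff.mp (Finset.mem_range.mp hi))]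
  rw [this]
  exact (MvPolynomial.isHomogeneous_C _ _).mul ((hA.pow i).mul (hB.pow _))

/-- Stated for a general φ because it serves twice: for substitution of the curve, where τ is the
variable, and for evaluation at a point, where τ is the parameter value A/B. -/
theorem map_homogenizeAt {S : Type*} [CommRing S] [Algebra k S] (φ : MvPolynomial (Fin 3) k →ₐ[k] S)
    {g : k[X]} {N : ℕ} (hg : g.natDegree ≤ N) {A B : MvPolynomial (Fin 3) k} {τ : S}
    (hAB : φ A = τ * φ B) : φ (homogenizeAt g N A B) = φ B ^ N * aeval τ g := by
  rw [homogenizeAt, aeval_eq_sum_range' (Nat.lt_succ_of_le hg), map_sum, Finset.mul_sum]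
  refine Finset.sum_congr rfl fun i hi => ?_
  rw [map_mul, map_mul, map_pow, map_pow, hAB, ← MvPolynomial.algebraMap_eq, AlgHom.commutes,
    Algebra.smul_def]
  conv_rhs => rw [← Nat.add_sub_cancel' (Nat.lt_succ_iff.mp (Finset.mem_range.mp hi)), pow_add]
  ring

/-- If the parameter of a parametrized curve is the quotient `A / B` of two forms, then all but
finitely many points of the curve come from parameters avoiding the roots of a given polynomial. -/
theorem IsEquation.finite_diff_range [CharZero k] {γ : Fin 3 → k[X]} {F : MvPolynomial (Fin 3) k}
    (hF : IsEquation γ F) (hw : ∀ i j, i ≠ j → wronskian (γ i) (γ j) ≠ 0)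
    {A B : MvPolynomial (Fin 3) k} {e : ℕ} (hA : A.IsHomogeneous e) (hB : B.IsHomogeneous e)
    (hAB : MvPolynomial.aeval γ A = X * MvPolynomial.aeval γ B)
    (hB0 : MvPolynomial.aeval γ B ≠ 0) {r : k[X]} (hr : r ≠ 0) :
    {p : ProjPlane k | VanishesAt F p ∧ ¬ ∃ (t : k) (h : (fun i => (γ i).eval t) ≠ 0),
      r.eval t ≠ 0 ∧ p = Projectivization.mk k (fun i => (γ i).eval t) h}.Finite := by
  have hγ0 : γ 0 ≠ 0 := fun h => hw 0 1 (by decide) (by rw [h, wronskian_zero_left])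
  set N := (r * γ 0).natDegree + (γ 0).natDegree + (γ 1).natDegree + (γ 2).natDegree with hN
  have hdeg : ∀ i, (γ i).natDegree ≤ N := by
    intro i
    fin_cases i <;> simp only [Fin.zero_eta, Fin.mk_one, Fin.reduceFinMk, hN] <;> omega
  have hdeg' : (r * γ 0).natDegree ≤ N := by omega
  -- `K` collects the bad points: those where A/B is undefined, and those whose parameter is a root
  -- of `r` or of the first coordinate. It does not vanish identically on the curve, so it has
  -- finitely many zeros there.
  set K := B * homogenizeAt (r * γ 0) N A B with hK
  have hKh : K.IsHomogeneous (e + e * N) := hB.mul (homogenizeAt_isHomogeneous _ _ hA hB)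
  refine (hF.finite_common_zeros hw hKh ?_).subset fun p ⟨hp, hp'⟩ => ⟨hp, ?_⟩
  · rw [hK, map_mul, map_homogenizeAt _ hdeg' hAB, aeval_X_left_apply]
    exact mul_ne_zero hB0 (mul_ne_zero (pow_ne_zero _ hB0) (mul_ne_zero hr hγ0))
  by_contra hKp
  rw [VanishesAt, hK, map_mul] at hKp
  have hBp := left_ne_zero_of_mul hKp
  set t := MvPolynomial.eval p.rep A / MvPolynomial.eval p.rep B with ht
  have hABp : MvPolynomial.aeval p.rep A = t * MvPolynomial.aeval p.rep B := by
    rw [MvPolynomial.aeval_eq_eval]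
    exact (div_mul_cancel₀ _ hBp).symm
  have hev : ∀ g : k[X], g.natDegree ≤ N → MvPolynomial.eval p.rep (homogenizeAt g N A B) =
      MvPolynomial.eval p.rep B ^ N * g.eval t := by
    intro g hg
    have := map_homogenizeAt (MvPolynomial.aeval p.rep) hg hABp
    rwa [MvPolynomial.aeval_eq_eval, coe_aeval_eq_eval] at this
  have hr0 : (r * γ 0).eval t ≠ 0 := by
    have := right_ne_zero_of_mul hKp
    rw [hev _ hdeg'] at this
    exact right_ne_zero_of_mul this
  rw [eval_mul] at hr0
  have hg0 := right_ne_zero_of_mul hr0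
  have hvec : (fun i => (γ i).eval t) ≠ 0 := fun h => hg0 (congrFun h 0)
  refine hp' ⟨t, hvec, left_ne_zero_of_mul hr0, ?_⟩
  -- The form expressing X_i γ₀(A/B) = X₀ γ_i(A/B) vanishes along the parametrization, so `F`
  -- divides it and it also vanishes at p.
  have hcross : ∀ i, p.rep i * (γ 0).eval t = p.rep 0 * (γ i).eval t := by
    intro i
    have hh : (MvPolynomial.X i * homogenizeAt (γ 0) N A B -
        MvPolynomial.X 0 * homogenizeAt (γ i) N A B).IsHomogeneous (1 + e * N) :=
      ((MvPolynomial.isHomogeneous_X _ _).mul (homogenizeAt_isHomogeneous _ _ hA hB)).sub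
        ((MvPolynomial.isHomogeneous_X _ _).mul (homogenizeAt_isHomogeneous _ _ hA hB))
    obtain ⟨c, hc⟩ := (hF.dvd_iff hh).mpr (by
      rw [map_sub, map_mul, map_mul, map_homogenizeAt _ (hdeg 0) hAB,
        map_homogenizeAt _ (hdeg i) hAB, aeval_X_left_apply, aeval_X_left_apply,
        MvPolynomial.aeval_X, MvPolynomial.aeval_X]
      ring)
    have h1 := congrArg (MvPolynomial.eval p.rep) hc
    rw [map_mul, show MvPolynomial.eval p.rep F = 0 from hp, zero_mul, map_sub, map_mul, map_mul,
      hev _ (hdeg 0), hev _ (hdeg i), MvPolynomial.eval_X, MvPolynomial.eval_X] at h1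
    have h2 : MvPolynomial.eval p.rep B ^ N *
        (p.rep i * (γ 0).eval t - p.rep 0 * (γ i).eval t) = 0 := by linear_combination h1
    exact sub_eq_zero.mp ((mul_eq_zero.mp h2).resolve_left (pow_ne_zero _ hBp))
  rw [← Projectivization.mk_rep p, Projectivization.mk_eq_mk_iff']
  refine ⟨p.rep 0 / (γ 0).eval t, funext fun i => ?_⟩
  rw [Pi.smul_apply, smul_eq_mul, div_mul_eq_mul_div, ← hcross, mul_div_cancel_right₀ _ hg0]

end CurvePoints

end

noncomputable section

/-! ### Dual curves, biduality and gradients -/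

section Duality

open Polynomial

variable {k : Type} [Field k]

/-- The curve of tangent lines of the plane curve parametrized by `γ`: the cross product of `γ`
with its derivative. -/
def dualCurve (γ : Fin 3 → k[X]) : Fin 3 → k[X] :=
  ![wronskian (γ 1) (γ 2), wronskian (γ 2) (γ 0), wronskian (γ 0) (γ 1)]

/-- The Wronskian determinant of the three coordinates of `γ`. -/
def wronskianDet (γ : Fin 3 → k[X]) : k[X] :=
  ∑ i, dualCurve γ i * derivative (derivative (γ i))

/-- Biduality: the dual of the dual curve is the curve itself. -/
theorem dualCurve_dualCurve (γ : Fin 3 → k[X]) (i : Fin 3) :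
    dualCurve (dualCurve γ) i = wronskianDet γ * γ i := by
  fin_cases i <;>
  · simp only [wronskianDet, dualCurve, wronskian, Fin.sum_univ_three, Fin.zero_eta, Fin.mk_one,
      Fin.reduceFinMk, Matrix.cons_val, derivative_sub, derivative_mul]
    ring

theorem sum_mul_dualCurve (γ : Fin 3 → k[X]) : ∑ i, γ i * dualCurve γ i = 0 := by
  simp only [dualCurve, wronskian, Fin.sum_univ_three, Matrix.cons_val]
  ring

theorem wronskian_ne_zero_of_dualCurve_ne_zero {γ : Fin 3 → k[X]} (h : ∀ i, dualCurve γ i ≠ 0)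
    (i j : Fin 3) (hij : i ≠ j) : wronskian (γ i) (γ j) ≠ 0 := by
  have h0 := h 0
  have h1 := h 1
  have h2 := h 2
  simp only [dualCurve, Matrix.cons_val] at h0 h1 h2
  have hs : ∀ a b : k[X], wronskian a b ≠ 0 → wronskian b a ≠ 0 := fun a b hab => by
    rw [← wronskian_neg_eq]; exact neg_ne_zero.mpr hab
  have h0' := hs _ _ h0
  have h1' := hs _ _ h1
  have h2' := hs _ _ h2
  fin_cases i <;> fin_cases j <;> simp only [Fin.zero_eta, Fin.mk_one, Fin.reduceFinMk] <;>
    first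
    | with_reducible assumption
    | exact absurd rfl hij

theorem dualCurve_eq_zero_of_eq_zero {γ : Fin 3 → k[X]} {i : Fin 3} (h : γ i = 0) :
    ∃ j, dualCurve γ j = 0 := by
  fin_cases i
  · exact ⟨1, by simp only [Fin.zero_eta] at h; simp [dualCurve, h]⟩
  · exact ⟨2, by simp only [Fin.mk_one] at h; simp [dualCurve, h]⟩
  · exact ⟨0, by simp only [Fin.reduceFinMk] at h; simp [dualCurve, h]⟩

theorem apply_ne_zero_of_wronskianDet_ne_zero {γ : Fin 3 → k[X]} (h : wronskianDet γ ≠ 0)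
    (i : Fin 3) : γ i ≠ 0 := by
  intro h0
  apply h
  fin_cases i <;> simp only [Fin.zero_eta, Fin.mk_one, Fin.reduceFinMk] at h0 <;>
    simp [wronskianDet, dualCurve, Fin.sum_univ_three, h0]

theorem dualCurve_dualCurve_ne_zero {γ : Fin 3 → k[X]} (h : wronskianDet γ ≠ 0) (i : Fin 3) :
    dualCurve (dualCurve γ) i ≠ 0 := by
  rw [dualCurve_dualCurve]
  exact mul_ne_zero h (apply_ne_zero_of_wronskianDet_ne_zero h i)

/-- A zero coordinate of δ forces a zero coordinate of δ × δ', contrary to biduality. -/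
theorem dualCurve_ne_zero {γ : Fin 3 → k[X]} (h : wronskianDet γ ≠ 0) (i : Fin 3) :
    dualCurve γ i ≠ 0 := by
  intro h0
  obtain ⟨j, hj⟩ := dualCurve_eq_zero_of_eq_zero h0
  exact dualCurve_dualCurve_ne_zero h j hj

/-- The gradient of a form vanishing on a parametrized curve is proportional to the dual curve. -/
theorem gradient_mul_dualCurve {γ : Fin 3 → k[X]} {F : MvPolynomial (Fin 3) k} {n : ℕ}
    (hF : F.IsHomogeneous n) (h0 : MvPolynomial.aeval γ F = 0) (i j : Fin 3) :
    MvPolynomial.aeval γ (MvPolynomial.pderiv i F) * dualCurve γ j =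
      MvPolynomial.aeval γ (MvPolynomial.pderiv j F) * dualCurve γ i := by
  -- By Euler and the chain rule the gradient is orthogonal to γ and γ', hence parallel to γ × γ'.
  have h1 := derivative_aeval γ F
  have h2 := congrArg (MvPolynomial.aeval γ) hF.sum_X_mul_pderiv
  rw [h0] at h1
  simp only [Fin.sum_univ_three, map_add, map_mul, MvPolynomial.aeval_X, map_nsmul, h0, smul_zero,
    derivative_zero] at h1 h2
  set p := MvPolynomial.aeval γ (MvPolynomial.pderiv 0 F)
  set q := MvPolynomial.aeval γ (MvPolynomial.pderiv 1 F)
  set r := MvPolynomial.aeval γ (MvPolynomial.pderiv 2 F)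
  have e01 : p * dualCurve γ 1 = q * dualCurve γ 0 := by
    simp only [dualCurve, wronskian, Matrix.cons_val]
    linear_combination (- γ 2) * h1 - derivative (γ 2) * h2
  have e12 : q * dualCurve γ 2 = r * dualCurve γ 1 := by
    simp only [dualCurve, wronskian, Matrix.cons_val]
    linear_combination (- γ 0) * h1 - derivative (γ 0) * h2
  have e20 : r * dualCurve γ 0 = p * dualCurve γ 2 := by
    simp only [dualCurve, wronskian, Matrix.cons_val]
    linear_combination (- γ 1) * h1 - derivative (γ 1) * h2
  have e10 := e01.symm
  have e21 := e12.symm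
  have e02 := e20.symm
  fin_cases i <;> fin_cases j <;> simp only [Fin.zero_eta, Fin.mk_one, Fin.reduceFinMk] <;>
    with_reducible assumption

/-- The equation of a parametrized curve is not constant. -/
theorem IsEquation.totalDegree_ne_zero {γ : Fin 3 → k[X]} {F : MvPolynomial (Fin 3) k}
    (hF : IsEquation γ F) : F.totalDegree ≠ 0 := by
  intro h
  rw [MvPolynomial.totalDegree_eq_zero_iff_eq_C] at h
  have h0 := hF.ne_zero
  refine hF.prime.not_isUnit ?_
  rw [h]
  refine (IsUnit.mk0 (F.coeff 0) fun hc => h0 ?_).map MvPolynomial.C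
  rw [h, hc, map_zero]

/-- The gradient of the equation of a curve does not vanish identically along the curve. -/
theorem IsEquation.exists_aeval_pderiv_ne_zero [CharZero k] {γ : Fin 3 → k[X]}
    {F : MvPolynomial (Fin 3) k} (hF : IsEquation γ F) :
    ∃ i, MvPolynomial.aeval γ (MvPolynomial.pderiv i F) ≠ 0 := by
  by_contra! h
  -- A partial derivative vanishing on the curve is divisible by `F` and has smaller degree, so it
  -- is zero. Euler's relation then contradicts F ≠ 0.
  have hp : ∀ i, MvPolynomial.pderiv i F = 0 := by
    intro i
    by_contra h0
    have hi := hF.homogeneous.pderiv (i := i)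
    have h1 := MvPolynomial.totalDegree_le_of_dvd_of_isDomain ((hF.dvd_iff hi).mpr (h i)) h0
    rw [hi.totalDegree h0] at h1
    have := hF.totalDegree_ne_zero
    omega
  have h1 := hF.homogeneous.sum_X_mul_pderiv
  simp only [hp, mul_zero, Finset.sum_const_zero] at h1
  rw [eq_comm, smul_eq_zero] at h1
  exact h1.elim hF.totalDegree_ne_zero hF.ne_zero

end Duality

/-! ### Taylor expansion along lines and tangent cones -/

section Expansion

open Polynomial

variable {k : Type} [Field k]

/-- The restriction `F (p + s * v)` of `F` to a parametrized line, as a polynomial in `s`. -/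
def lineExpansion (F : MvPolynomial (Fin 3) k) (p v : Fin 3 → k) : k[X] :=
  MvPolynomial.aeval (fun i => C (p i) + X * C (v i)) F

theorem coeff_lineExpansion (G : MvPolynomial (Fin 3) k) (p v : Fin 3 → k) (n : ℕ) :
    (lineExpansion G p v).coeff n = MvPolynomial.eval v (MvPolynomial.homogeneousComponent n
      (MvPolynomial.aeval (fun i => MvPolynomial.C (p i) + MvPolynomial.X i) G)) := by
  have h : (MvPolynomial.aeval fun i => (X : k[X]) * C (v i)).comp
      (MvPolynomial.aeval (R := k) fun i => MvPolynomial.C (p i) + MvPolynomial.X i) =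
      MvPolynomial.aeval fun i => C (p i) + X * C (v i) := by
    refine MvPolynomial.algHom_ext fun i => ?_
    rw [AlgHom.comp_apply, MvPolynomial.aeval_X, MvPolynomial.aeval_X, map_add,
      MvPolynomial.aeval_X, MvPolynomial.aeval_C]
    rfl
  rw [← MvPolynomial.aeval_eq_eval, ← coeff_aeval_X_mul_C, ← AlgHom.comp_apply, h]
  rfl

theorem eval_lineExpansion (G : MvPolynomial (Fin 3) k) (p v : Fin 3 → k) (x : k) :
    (lineExpansion G p v).eval x = MvPolynomial.eval (p + x • v) G := by
  have h : (Polynomial.aeval x).comp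
      (MvPolynomial.aeval fun i => C (p i) + X * C (v i)) = MvPolynomial.aeval (p + x • v) := by
    refine MvPolynomial.algHom_ext fun i => ?_
    rw [AlgHom.comp_apply, MvPolynomial.aeval_X, MvPolynomial.aeval_X, coe_aeval_eq_eval, eval_add,
      eval_mul, eval_C, eval_C, eval_X]
    rfl
  have h1 := DFunLike.congr_fun h G
  rwa [AlgHom.comp_apply, coe_aeval_eq_eval, MvPolynomial.aeval_eq_eval] at h1

theorem eval_derivative_lineExpansion (G : MvPolynomial (Fin 3) k) (p v : Fin 3 → k) (x : k) :
    (derivative (lineExpansion G p v)).eval x =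
      ∑ i, MvPolynomial.eval (p + x • v) (MvPolynomial.pderiv i G) * v i := by
  rw [lineExpansion, derivative_aeval, eval_finsetSum]
  refine Finset.sum_congr rfl fun i _ => ?_
  rw [eval_mul, ← eval_lineExpansion, lineExpansion]
  simp

theorem natDegree_lineExpansion_le_and_coeff {G : MvPolynomial (Fin 3) k} {d : ℕ}
    (hG : G.IsHomogeneous d) (p v : Fin 3 → k) :
    (lineExpansion G p v).natDegree ≤ d ∧ (lineExpansion G p v).coeff d = MvPolynomial.eval v G := by
  have hl : ∀ i, (C (p i) + X * C (v i)).natDegree ≤ 1 := fun i => by compute_degree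
  have hc : ∀ i, (C (p i) + X * C (v i)).coeff 1 = v i := fun i => by
    simp [coeff_C]
  have hp : ∀ i m, ((C (p i) + X * C (v i)) ^ m).natDegree ≤ m ∧
      ((C (p i) + X * C (v i)) ^ m).coeff m = v i ^ m := fun i m => by
    have h1 := natDegree_pow_le_of_le m (hl i)
    have h2 := coeff_pow_of_natDegree_le (m := m) (hl i)
    rw [mul_one] at h1 h2
    exact ⟨h1, by rw [h2, hc]⟩
  rw [lineExpansion, MvPolynomial.aeval_def, MvPolynomial.eval₂_eq', MvPolynomial.eval_eq']
  have hm : ∀ m ∈ G.support, (algebraMap k k[X] (G.coeff m) *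
        ∏ i, (C (p i) + X * C (v i)) ^ m i).natDegree ≤ d ∧
      (algebraMap k k[X] (G.coeff m) * ∏ i, (C (p i) + X * C (v i)) ^ m i).coeff d =
        G.coeff m * ∏ i, v i ^ m i := by
    intro m hm
    have hd : d = m 0 + m 1 + m 2 := by
      have := hG (MvPolynomial.mem_support_iff.mp hm)
      rw [Finsupp.weight_apply, Finsupp.sum_fintype _ _ (by simp)] at this
      rw [← this]
      simp [Fin.sum_univ_three]
    rw [Polynomial.algebraMap_apply, Algebra.algebraMap_self, RingHom.id_apply, coeff_C_mul,
      Fin.prod_univ_three, Fin.prod_univ_three, hd]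
    have h01 := natDegree_mul_le_of_le (hp 0 (m 0)).1 (hp 1 (m 1)).1
    refine ⟨(natDegree_C_mul_le _ _).trans (natDegree_mul_le_of_le h01 (hp 2 (m 2)).1), ?_⟩
    rw [coeff_mul_add_eq_of_natDegree_le h01 (hp 2 (m 2)).1,
      coeff_mul_add_eq_of_natDegree_le (hp 0 (m 0)).1 (hp 1 (m 1)).1, (hp 0 _).2, (hp 1 _).2, (hp 2 _).2]
  refine ⟨natDegree_sum_le_of_forall_le _ _ fun m h => (hm m h).1, ?_⟩
  rw [finsetSum_coeff]
  exact Finset.sum_congr rfl fun m h => (hm m h).2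

theorem expandAt_eq_lineExpansion (G : MvPolynomial (Fin 3) ℂ) (p v : Fin 3 → ℂ) :
    expandAt G p v = lineExpansion G p v := rfl

/-- The first nonzero Taylor form of `G` at the point `p`, whose zeros are the tangent directions. -/
def tangentCone (G : MvPolynomial (Fin 3) ℂ) (p : ProjPlane ℂ) : MvPolynomial (Fin 3) ℂ :=
  MvPolynomial.homogeneousComponent (multiplicityAt G p)
    (MvPolynomial.aeval (fun i => MvPolynomial.C (p.rep i) + MvPolynomial.X i) G)

theorem eval_tangentCone (G : MvPolynomial (Fin 3) ℂ) (p : ProjPlane ℂ) (v : Fin 3 → ℂ) :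
    MvPolynomial.eval v (tangentCone G p) = (expandAt G p.rep v).coeff (multiplicityAt G p) :=
  (coeff_lineExpansion G p.rep v _).symm

theorem tangentCone_isHomogeneous (G : MvPolynomial (Fin 3) ℂ) (p : ProjPlane ℂ) :
    (tangentCone G p).IsHomogeneous (multiplicityAt G p) :=
  MvPolynomial.homogeneousComponent_isHomogeneous _ _

/-- Some Taylor form is nonzero, so the infimum defining the multiplicity is attained: otherwise the
expansion towards any x, taken at s = 1, would give G(x) = 0. -/
theorem tangentCone_ne_zero {G : MvPolynomial (Fin 3) ℂ} (hG : G ≠ 0) (p : ProjPlane ℂ) :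
    tangentCone G p ≠ 0 := by
  have hne : {n | ∃ v : Fin 3 → ℂ, (expandAt G p.rep v).coeff n ≠ 0}.Nonempty := by
    by_contra! h
    apply hG
    refine MvPolynomial.funext fun x => ?_
    have h0 : expandAt G p.rep (x - p.rep) = 0 := by
      ext n
      by_contra hn
      have : n ∈ (∅ : Set ℕ) := h ▸ ⟨_, hn⟩
      exact this
    have h1 := eval_lineExpansion G p.rep (x - p.rep) 1
    rw [← expandAt_eq_lineExpansion, h0, eval_zero, one_smul, add_sub_cancel] at h1
    rw [← h1, map_zero]
  obtain ⟨v, hv⟩ := Nat.sInf_mem hne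
  intro h0
  apply hv
  have := eval_tangentCone G p v
  rw [h0, map_zero] at this
  exact this.symm

end Expansion

end

noncomputable section

/-! ### Proportionality of vectors and transversal line sections -/

section PointLemmas

open Polynomial

variable {k : Type} [Field k]

theorem eval_aeval_curve (γ : Fin 3 → k[X]) (F : MvPolynomial (Fin 3) k) (t : k) :
    (MvPolynomial.aeval γ F).eval t = MvPolynomial.eval (fun i => (γ i).eval t) F := by
  have h : (Polynomial.aeval t).comp (MvPolynomial.aeval γ) =
      MvPolynomial.aeval fun i => (γ i).eval t := by
    refine MvPolynomial.algHom_ext fun i => ?_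
    rw [AlgHom.comp_apply, MvPolynomial.aeval_X, MvPolynomial.aeval_X, coe_aeval_eq_eval]
  have h1 := DFunLike.congr_fun h F
  rwa [AlgHom.comp_apply, coe_aeval_eq_eval, MvPolynomial.aeval_eq_eval] at h1

theorem dotProduct_rep_mk_eq_zero_iff (w v : Fin 3 → k) (hv : v ≠ 0) :
    w ⬝ᵥ (Projectivization.mk k v hv).rep = 0 ↔ w ⬝ᵥ v = 0 := by
  obtain ⟨a, ha⟩ := Projectivization.exists_smul_eq_mk_rep k v hv
  rw [← ha, Units.smul_def, dotProduct_smul, smul_eq_mul, mul_eq_zero, or_iff_right a.ne_zero]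

theorem mk_eq_mk_of_cross {v w : Fin 3 → k} (hv : v ≠ 0) (hw : w ≠ 0)
    (h : ∀ i j, v i * w j = v j * w i) :
    Projectivization.mk k v hv = Projectivization.mk k w hw := by
  obtain ⟨j, hj⟩ := Function.ne_iff.mp hw
  rw [Pi.zero_apply] at hj
  rw [Projectivization.mk_eq_mk_iff']
  refine ⟨v j / w j, funext fun i => ?_⟩
  rw [Pi.smul_apply, smul_eq_mul, div_mul_eq_mul_div, ← h i j, mul_div_cancel_right₀ _ hj]

theorem eq_mk_of_cross {p : ProjPlane k} {w : Fin 3 → k} (hw : w ≠ 0)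
    (h : ∀ i j, p.rep i * w j = p.rep j * w i) : p = Projectivization.mk k w hw := by
  conv_lhs => rw [← Projectivization.mk_rep p]
  exact mk_eq_mk_of_cross p.rep_nonzero hw h

/-- It suffices to test the vector a_i e_j - a_j e_i. -/
theorem cross_of_forall_dotProduct_eq_zero {a b : Fin 3 → k}
    (h : ∀ v, a ⬝ᵥ v = 0 → b ⬝ᵥ v = 0) (i j : Fin 3) : a i * b j = a j * b i := by
  have h1 := h (Pi.single j (a i) - Pi.single i (a j)) (by
    rw [dotProduct_sub, dotProduct_single, dotProduct_single]; ring)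
  rw [dotProduct_sub, dotProduct_single, dotProduct_single] at h1
  linear_combination h1

theorem dotProduct_eq_zero_of_cross {a b : Fin 3 → k} (ha : a ≠ 0)
    (h : ∀ i j, a i * b j = a j * b i) {v : Fin 3 → k} (hv : a ⬝ᵥ v = 0) : b ⬝ᵥ v = 0 := by
  obtain ⟨j, hj⟩ := Function.ne_iff.mp ha
  rw [Pi.zero_apply] at hj
  have : a j * (b ⬝ᵥ v) = b j * (a ⬝ᵥ v) := by
    simp only [dotProduct, Finset.mul_sum]
    refine Finset.sum_congr rfl fun i _ => ?_
    linear_combination v i * h j i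
  rw [hv, mul_zero] at this
  exact (mul_eq_zero.mp this).resolve_left hj

/-- A curve `E = 0` meets a line transversal to it in exactly `deg E` points. -/
theorem encard_line_section [IsAlgClosed k] {E : MvPolynomial (Fin 3) k} {d : ℕ}
    (hE : E.IsHomogeneous d) {q : Fin 3 → k} (hq : q 2 ≠ 0)
    (hY : ∀ v : Fin 3 → k, v ≠ 0 → v ⬝ᵥ q = 0 → v 1 = 0 → MvPolynomial.eval v E ≠ 0)
    (hs : ∀ v : Fin 3 → k, v ≠ 0 → v ⬝ᵥ q = 0 → MvPolynomial.eval v E = 0 →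
      ∃ i, MvPolynomial.eval v (MvPolynomial.pderiv i E) * q 2 ≠
        MvPolynomial.eval v (MvPolynomial.pderiv 2 E) * q i) :
    {l : ProjPlane k | VanishesAt E l ∧ l.rep ⬝ᵥ q = 0}.encard = d := by
  classical
  -- `u` and `w` span the plane orthogonal to `q`. The points w + xu miss only the class of `u`,
  -- whose middle coordinate is zero, and `hY` keeps it off the curve; hence the restricted
  -- polynomial has full degree d.
  set u : Fin 3 → k := ![q 2, 0, -q 0] with hu
  set w : Fin 3 → k := ![0, q 2, -q 1] with hw
  have hv0 : ∀ x : k, (w + x • u) 0 = x * q 2 := fun x => by simp [hu, hw]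
  have hv1 : ∀ x : k, (w + x • u) 1 = q 2 := fun x => by simp [hu, hw]
  have hv2 : ∀ x : k, (w + x • u) 2 = -q 1 - x * q 0 := fun x => by simp [hu, hw]; ring
  have hvne : ∀ x : k, w + x • u ≠ 0 := fun x h => hq (by rw [← hv1 x, h, Pi.zero_apply])
  have hvq : ∀ x : k, (w + x • u) ⬝ᵥ q = 0 := fun x => by
    rw [dotProduct, Fin.sum_univ_three, hv0, hv1, hv2]; ring
  set φ := lineExpansion E w u with hφ
  have hφe : ∀ x, φ.eval x = MvPolynomial.eval (w + x • u) E := eval_lineExpansion E w u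
  obtain ⟨hdeg, hcoeff⟩ := natDegree_lineExpansion_le_and_coeff hE w u
  have hlead : φ.coeff d ≠ 0 := by
    rw [hφ, hcoeff]
    refine hY u (fun h => hq (congrFun h 0)) ?_ rfl
    rw [dotProduct, Fin.sum_univ_three]
    simp [hu]; ring
  have hφ0 : φ ≠ 0 := fun h => hlead (by rw [h, coeff_zero])
  have hnat : φ.natDegree = d := le_antisymm hdeg (le_natDegree_of_ne_zero hlead)
  -- At a double root the gradient kills `u`, and by Euler also w + xu, so it is parallel to `q`,
  -- against `hs`.
  have hnodup : φ.roots.Nodup := by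
    rw [Multiset.nodup_iff_count_le_one]
    intro x
    rw [count_roots]
    by_contra! hx
    rw [one_lt_rootMultiplicity_iff_isRoot hφ0, IsRoot.def, IsRoot.def, hφe, hφ,
      eval_derivative_lineExpansion] at hx
    obtain ⟨h1, h2⟩ := hx
    have h3 := congrArg (MvPolynomial.eval (w + x • u)) hE.sum_X_mul_pderiv
    rw [map_nsmul, h1, smul_zero, map_sum] at h3
    simp only [Fin.sum_univ_three, map_mul, MvPolynomial.eval_X, hv0, hv1, hv2] at h3
    rw [Fin.sum_univ_three] at h2
    simp only [hu, Matrix.cons_val] at h2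
    obtain ⟨i, hi⟩ := hs _ (hvne x) (hvq x) h1
    apply hi
    fin_cases i
    · simp only [Fin.zero_eta]
      linear_combination h2
    · simp only [Fin.mk_one]
      linear_combination h3 - x * h2
    · rfl
  have hset : {l : ProjPlane k | VanishesAt E l ∧ l.rep ⬝ᵥ q = 0} =
      (fun x => Projectivization.mk k (w + x • u) (hvne x)) '' (φ.roots.toFinset : Set k) := by
    ext l
    simp only [Set.mem_ofPred_eq, Set.mem_image, Finset.mem_coe, Multiset.mem_toFinset,
      mem_roots hφ0, IsRoot.def, hφe]
    constructor
    · rintro ⟨h1, h2⟩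
      have hl1 : l.rep 1 ≠ 0 := fun h => hY l.rep l.rep_nonzero h2 h h1
      have hl : (l.rep 1 / q 2) • (w + (l.rep 0 / l.rep 1) • u) = l.rep := by
        rw [dotProduct, Fin.sum_univ_three] at h2
        funext i
        fin_cases i <;>
          simp only [Fin.zero_eta, Fin.mk_one, Fin.reduceFinMk, Pi.smul_apply, smul_eq_mul, hv0,
            hv1, hv2]
        · field_simp
        · field_simp
        · field_simp
          linear_combination -h2
      refine ⟨l.rep 0 / l.rep 1, ?_, ?_⟩
      · rw [← hE.eval_smul_eq_zero_iff (div_ne_zero hl1 hq), hl]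
        exact h1
      · conv_rhs => rw [← Projectivization.mk_rep l]
        exact ((Projectivization.mk_eq_mk_iff' k _ _ l.rep_nonzero (hvne _)).mpr ⟨_, hl⟩).symm
    · rintro ⟨x, hx, rfl⟩
      refine ⟨(vanishesAt_mk hE _ _).mpr hx, ?_⟩
      rw [dotProduct_comm, dotProduct_rep_mk_eq_zero_iff, dotProduct_comm]
      exact hvq x
  rw [hset, Set.InjOn.encard_image, Set.encard_coe_eq_coe_finsetCard,
    Multiset.toFinset_card_of_nodup hnodup, ← hnat,
    (IsAlgClosed.splits φ).natDegree_eq_card_roots]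
  intro x _ y _ hxy
  rw [Projectivization.mk_eq_mk_iff'] at hxy
  obtain ⟨c, hc⟩ := hxy
  have h1 := congrFun hc 1
  have h0 := congrFun hc 0
  rw [Pi.smul_apply, hv1, hv1, smul_eq_mul] at h1
  have hc1 : c = 1 := mul_right_cancel₀ hq (by rw [h1, one_mul])
  rw [Pi.smul_apply, hv0, hv0, hc1, one_smul] at h0
  exact (mul_right_cancel₀ hq h0).symm

end PointLemmas

/-! ### Tangents at smooth points -/

section Tangents

open Polynomial

theorem coeff_one_expandAt (G : MvPolynomial (Fin 3) ℂ) (p v : Fin 3 → ℂ) :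
    (expandAt G p v).coeff 1 =
      (fun i => MvPolynomial.eval p (MvPolynomial.pderiv i G)) ⬝ᵥ v := by
  have h1 := eval_derivative_lineExpansion G p v 0
  rw [zero_smul, add_zero, ← coeff_zero_eq_eval_zero, coeff_derivative] at h1
  rw [dotProduct, ← h1, expandAt_eq_lineExpansion]
  simp

theorem multiplicityAt_eq_one {G : MvPolynomial (Fin 3) ℂ} {p : ProjPlane ℂ} (hp : VanishesAt G p)
    {i : Fin 3} (hi : MvPolynomial.eval p.rep (MvPolynomial.pderiv i G) ≠ 0) :
    multiplicityAt G p = 1 := by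
  have h1 : 1 ∈ {n | ∃ v : Fin 3 → ℂ, (expandAt G p.rep v).coeff n ≠ 0} := by
    refine ⟨Pi.single i 1, ?_⟩
    rwa [coeff_one_expandAt, dotProduct_single, mul_one]
  have h0 : 0 ∉ {n | ∃ v : Fin 3 → ℂ, (expandAt G p.rep v).coeff n ≠ 0} := by
    rintro ⟨v, hv⟩
    apply hv
    rw [expandAt_eq_lineExpansion, coeff_zero_eq_eval_zero, eval_lineExpansion, zero_smul, add_zero]
    exact hp
  refine le_antisymm (Nat.sInf_le h1) (Nat.one_le_iff_ne_zero.mpr fun h => ?_)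
  have h2 := Nat.sInf_mem ⟨1, h1⟩
  rw [multiplicityAt] at h
  rw [h] at h2
  exact h0 h2

/-- At a smooth point of a parametrized curve, the only tangent is given by the dual curve. -/
theorem IsEquation.isTangentAt_mk_iff {γ : Fin 3 → ℂ[X]} {G : MvPolynomial (Fin 3) ℂ}
    (hG : IsEquation γ G) {t : ℂ} (hγ : (fun i => (γ i).eval t) ≠ 0)
    (hδ : (fun i => (dualCurve γ i).eval t) ≠ 0) {i₀ : Fin 3}
    (hi₀ : (MvPolynomial.aeval γ (MvPolynomial.pderiv i₀ G)).eval t ≠ 0) (l : ProjPlane ℂ) :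
    IsTangentAt G l (Projectivization.mk ℂ (fun i => (γ i).eval t) hγ) ↔
      l = Projectivization.mk ℂ (fun i => (dualCurve γ i).eval t) hδ := by
  set p := Projectivization.mk ℂ (fun i => (γ i).eval t) hγ with hp
  have hGp : VanishesAt G p := by
    rw [hp, vanishesAt_mk hG.homogeneous, ← eval_aeval_curve, hG.aeval_eq_zero, eval_zero]
  obtain ⟨c, hc⟩ := Projectivization.exists_smul_eq_mk_rep ℂ _ hγ
  rw [← hp, Units.smul_def] at hc
  have hgr : ∀ i, MvPolynomial.eval p.rep (MvPolynomial.pderiv i G) =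
      (c : ℂ) ^ (G.totalDegree - 1) * (MvPolynomial.aeval γ (MvPolynomial.pderiv i G)).eval t := by
    intro i
    rw [← hc, (hG.homogeneous.pderiv (i := i)).eval_smul, eval_aeval_curve]
  have hi₁ : MvPolynomial.eval p.rep (MvPolynomial.pderiv i₀ G) ≠ 0 := by
    rw [hgr]
    exact mul_ne_zero (pow_ne_zero _ c.ne_zero) hi₀
  set g : Fin 3 → ℂ := fun i => MvPolynomial.eval p.rep (MvPolynomial.pderiv i G) with hg
  have hg0 : g ≠ 0 := fun h => hi₁ (congrFun h i₀)
  have hcross : ∀ i j, g i * (dualCurve γ j).eval t = g j * (dualCurve γ i).eval t := by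
    intro i j
    have h1 := congrArg (eval t)
      (gradient_mul_dualCurve hG.homogeneous hG.aeval_eq_zero i j)
    rw [eval_mul, eval_mul] at h1
    simp only [hg, hgr]
    linear_combination (c : ℂ) ^ (G.totalDegree - 1) * h1
  -- With multiplicity one the first Taylor form is the gradient pairing, so tangency makes l
  -- parallel to the gradient.
  have htan : IsTangentAt G l p ↔ LiesOn p l ∧ ∀ v, l.rep ⬝ᵥ v = 0 → g ⬝ᵥ v = 0 := by
    rw [IsTangentAt, multiplicityAt_eq_one hGp hi₁]
    simp only [coeff_one_expandAt, hGp, true_and, hg]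
  rw [htan]
  constructor
  · rintro ⟨-, h⟩
    have h1 := cross_of_forall_dotProduct_eq_zero h
    refine eq_mk_of_cross hδ fun i j => ?_
    have h2 : g i₀ * (l.rep i * (dualCurve γ j).eval t) =
        g i₀ * (l.rep j * (dualCurve γ i).eval t) := by
      linear_combination l.rep i * hcross i₀ j + (dualCurve γ i₀).eval t * h1 i j -
        l.rep j * hcross i₀ i
    exact mul_left_cancel₀ hi₁ h2
  · intro hl
    obtain ⟨c', hc'⟩ := Projectivization.exists_smul_eq_mk_rep ℂ _ hδ
    rw [← hl, Units.smul_def] at hc'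
    refine ⟨?_, fun v hv => dotProduct_eq_zero_of_cross l.rep_nonzero (fun i j => ?_) hv⟩
    · rw [LiesOn, hp, dotProduct_rep_mk_eq_zero_iff, ← hc', smul_dotProduct]
      have h1 := congrArg (eval t) (sum_mul_dualCurve γ)
      rw [eval_finsetSum, eval_zero] at h1
      simp only [eval_mul] at h1
      rw [dotProduct, ← smul_zero (c' : ℂ), ← h1]
      congr 1
      exact Finset.sum_congr rfl fun i _ => mul_comm _ _
    · rw [← hc']
      simp only [Pi.smul_apply, smul_eq_mul]
      linear_combination -(c' : ℂ) * hcross i j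

end Tangents

end

noncomputable section

/-! ### The gradient of the dual equation -/

section DualEquation

open Polynomial

variable {k : Type} [Field k]

/-- Along the dual curve, the gradient of its equation is proportional to the original curve. -/
theorem IsEquation.gradient_dual {γ : Fin 3 → k[X]} {E : MvPolynomial (Fin 3) k}
    (hE : IsEquation (dualCurve γ) E) (hγ : wronskianDet γ ≠ 0) (i j : Fin 3) :
    MvPolynomial.aeval (dualCurve γ) (MvPolynomial.pderiv i E) * γ j =
      MvPolynomial.aeval (dualCurve γ) (MvPolynomial.pderiv j E) * γ i := by
  have h := gradient_mul_dualCurve hE.homogeneous hE.aeval_eq_zero i j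
  rw [dualCurve_dualCurve, dualCurve_dualCurve] at h
  apply mul_left_cancel₀ hγ
  linear_combination h

/-- Some partial is nonzero along δ, and the gradient is parallel to γ, all of whose coordinates are
nonzero. -/
theorem IsEquation.aeval_pderiv_dual_ne_zero [CharZero k] {γ : Fin 3 → k[X]}
    {E : MvPolynomial (Fin 3) k} (hE : IsEquation (dualCurve γ) E) (hγ : wronskianDet γ ≠ 0)
    (i : Fin 3) : MvPolynomial.aeval (dualCurve γ) (MvPolynomial.pderiv i E) ≠ 0 := by
  intro h
  obtain ⟨j, hj⟩ := hE.exists_aeval_pderiv_ne_zero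
  have h1 := hE.gradient_dual hγ i j
  rw [h, zero_mul, eq_comm, mul_eq_zero] at h1
  exact h1.elim hj (apply_ne_zero_of_wronskianDet_ne_zero hγ i)

/-- If the parameter of a curve is the quotient of the first by the last coordinate, all but
finitely many points of the dual curve come from parameters avoiding the roots of a given
polynomial. -/
theorem IsEquation.finite_diff_range_dual [CharZero k] {γ : Fin 3 → k[X]}
    {E : MvPolynomial (Fin 3) k} (hE : IsEquation (dualCurve γ) E) (hγ : wronskianDet γ ≠ 0)
    (hX : γ 0 = X * γ 2) {r : k[X]} (hr : r ≠ 0) :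
    {p : ProjPlane k | VanishesAt E p ∧ ¬ ∃ (t : k) (h : (fun i => (dualCurve γ i).eval t) ≠ 0),
      r.eval t ≠ 0 ∧ p = Projectivization.mk k (fun i => (dualCurve γ i).eval t) h}.Finite := by
  refine hE.finite_diff_range
    (wronskian_ne_zero_of_dualCurve_ne_zero (dualCurve_dualCurve_ne_zero hγ))
    (hE.homogeneous.pderiv (i := 0)) (hE.homogeneous.pderiv (i := 2)) ?_
    (hE.aeval_pderiv_dual_ne_zero hγ 2) hr
  have h := hE.gradient_dual hγ 0 2
  rw [hX] at h
  apply mul_right_cancel₀ (apply_ne_zero_of_wronskianDet_ne_zero hγ 2)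
  linear_combination h

theorem IsEquation.finite_diff_range_self [CharZero k] {γ : Fin 3 → k[X]}
    {G : MvPolynomial (Fin 3) k} (hG : IsEquation γ G) (hγ : wronskianDet γ ≠ 0)
    (hX : γ 0 = X * γ 2) {r : k[X]} (hr : r ≠ 0) :
    {p : ProjPlane k | VanishesAt G p ∧ ¬ ∃ (t : k) (h : (fun i => (γ i).eval t) ≠ 0),
      r.eval t ≠ 0 ∧ p = Projectivization.mk k (fun i => (γ i).eval t) h}.Finite :=
  hG.finite_diff_range (wronskian_ne_zero_of_dualCurve_ne_zero (dualCurve_ne_zero hγ))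
    (MvPolynomial.isHomogeneous_X _ 0) (MvPolynomial.isHomogeneous_X _ 2)
    (by rw [MvPolynomial.aeval_X, MvPolynomial.aeval_X, hX])
    (by rw [MvPolynomial.aeval_X]; exact apply_ne_zero_of_wronskianDet_ne_zero hγ 2) hr

/-- The linear form of the line with coordinates `l`. -/
def linearForm (l : Fin 3 → k) : MvPolynomial (Fin 3) k :=
  ∑ i, MvPolynomial.C (l i) * MvPolynomial.X i

theorem linearForm_isHomogeneous (l : Fin 3 → k) : (linearForm l).IsHomogeneous 1 :=
  MvPolynomial.IsHomogeneous.sum _ _ _ fun _ _ => MvPolynomial.isHomogeneous_C_mul_X _ _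

theorem eval_linearForm (l v : Fin 3 → k) : MvPolynomial.eval v (linearForm l) = l ⬝ᵥ v := by
  simp [linearForm, dotProduct]

theorem linearForm_ne_zero {l : Fin 3 → k} (hl : l ≠ 0) : linearForm l ≠ 0 := by
  obtain ⟨i, hi⟩ := Function.ne_iff.mp hl
  intro h
  apply hi
  have := eval_linearForm l (Pi.single i 1)
  rwa [h, map_zero, dotProduct_single, mul_one, eq_comm] at this

end DualEquation

/-! ### The class as the degree of the dual curve -/

section Class

open Polynomial

/-- The class of a parametrized curve is the degree of its dual curve. -/
theorem hasClass_of_isEquation_dualCurve {γ : Fin 3 → ℂ[X]} (hγ : wronskianDet γ ≠ 0)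
    (hX : γ 0 = X * γ 2) {G E : MvPolynomial (Fin 3) ℂ} (hG : IsEquation γ G)
    (hE : IsEquation (dualCurve γ) E) : HasClass G E.totalDegree := by
  obtain ⟨i₀, hi₀⟩ := hG.exists_aeval_pderiv_ne_zero
  -- Off the roots of `rG`, γ(t) is a smooth point and δ(t) is nonzero. `rE` also keeps γ₂(t) and
  -- ∂₂E at δ(t) nonzero, for the transversality argument.
  set rG : ℂ[X] := MvPolynomial.aeval γ (MvPolynomial.pderiv i₀ G) * dualCurve γ 0 with hrG
  set rE : ℂ[X] := rG * γ 2 * MvPolynomial.aeval (dualCurve γ) (MvPolynomial.pderiv 2 E) with hrE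
  have hrG0 : rG ≠ 0 := mul_ne_zero hi₀ (dualCurve_ne_zero hγ 0)
  have hrE0 : rE ≠ 0 := mul_ne_zero (mul_ne_zero hrG0 (apply_ne_zero_of_wronskianDet_ne_zero hγ 2))
    (hE.aeval_pderiv_dual_ne_zero hγ 2)
  have hwδ := wronskian_ne_zero_of_dualCurve_ne_zero (dualCurve_dualCurve_ne_zero hγ)
  have hfG := hG.finite_diff_range_self hγ hX hrG0
  have hfE := hE.finite_diff_range_dual hγ hX hrE0
  have hfY := hE.finite_common_zeros hwδ (MvPolynomial.isHomogeneous_X ℂ 1)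
    (by rw [MvPolynomial.aeval_X]; exact dualCurve_ne_zero hγ 1)
  set SG := hfG.toFinset
  set SE := hfE.toFinset
  set SY := hfY.toFinset
  -- The factors of H ensure in turn that q₂ ≠ 0, that q is off C, that q is on no line in `SE`
  -- (exceptional points of the dual curve) or in `SY` (its points with middle coordinate zero), and
  -- that q is on no tangent at an exceptional point of C.
  refine ⟨1 + G.totalDegree + ∑ _l ∈ SE, 1 + ∑ _l ∈ SY, 1 + ∑ p ∈ SG, multiplicityAt G p,
    MvPolynomial.X 2 * G * (∏ l ∈ SE, linearForm l.rep) *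
      (∏ l ∈ SY, linearForm l.rep) * ∏ p ∈ SG, tangentCone G p, ?_, ?_, fun q hq => ?_⟩
  · refine mul_ne_zero (mul_ne_zero (mul_ne_zero (mul_ne_zero (MvPolynomial.X_ne_zero 2)
      hG.ne_zero) ?_) ?_) ?_
    · exact Finset.prod_ne_zero_iff.mpr fun l _ => linearForm_ne_zero l.rep_nonzero
    · exact Finset.prod_ne_zero_iff.mpr fun l _ => linearForm_ne_zero l.rep_nonzero
    · exact Finset.prod_ne_zero_iff.mpr fun p _ => tangentCone_ne_zero hG.ne_zero p
  · exact ((((MvPolynomial.isHomogeneous_X ℂ 2).mul hG.homogeneous).mul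
      (MvPolynomial.IsHomogeneous.prod _ _ _ fun l _ => linearForm_isHomogeneous l.rep)).mul
      (MvPolynomial.IsHomogeneous.prod _ _ _ fun l _ => linearForm_isHomogeneous l.rep)).mul
      (MvPolynomial.IsHomogeneous.prod _ _ _ fun p _ => tangentCone_isHomogeneous G p)
  rw [VanishesAt, map_mul, map_mul, map_mul, map_mul, MvPolynomial.eval_X, map_prod, map_prod,
    map_prod] at hq
  have hTq := Finset.prod_ne_zero_iff.mp (right_ne_zero_of_mul hq)
  replace hq := left_ne_zero_of_mul hq
  have hYq := Finset.prod_ne_zero_iff.mp (right_ne_zero_of_mul hq)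
  replace hq := left_ne_zero_of_mul hq
  have hEq := Finset.prod_ne_zero_iff.mp (right_ne_zero_of_mul hq)
  replace hq := left_ne_zero_of_mul hq
  have hGq := right_ne_zero_of_mul hq
  replace hq := left_ne_zero_of_mul hq
  simp only [eval_linearForm] at hEq hYq
  have hgoodE : ∀ l : ProjPlane ℂ, VanishesAt E l → l.rep ⬝ᵥ q.rep = 0 →
      ∃ (t : ℂ) (h : (fun i => (dualCurve γ i).eval t) ≠ 0),
        rE.eval t ≠ 0 ∧ l = Projectivization.mk ℂ (fun i => (dualCurve γ i).eval t) h := by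
    intro l hl hlq
    by_contra h
    exact hEq l (hfE.mem_toFinset.mpr ⟨hl, h⟩) hlq
  have hset : {l ∈ tangentLines G | LiesOn q l} =
      {l | VanishesAt E l ∧ l.rep ⬝ᵥ q.rep = 0} := by
    ext l
    constructor
    · rintro ⟨⟨p, hp⟩, hlq⟩
      refine ⟨?_, hlq⟩
      by_cases hpG : ∃ (t : ℂ) (h : (fun i => (γ i).eval t) ≠ 0),
          rG.eval t ≠ 0 ∧ p = Projectivization.mk ℂ (fun i => (γ i).eval t) h
      · obtain ⟨t, ht, hr, rfl⟩ := hpG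
        rw [hrG, eval_mul] at hr
        have hδ : (fun i => (dualCurve γ i).eval t) ≠ 0 := fun h =>
          right_ne_zero_of_mul hr (congrFun h 0)
        rw [hG.isTangentAt_mk_iff ht hδ (left_ne_zero_of_mul hr)] at hp
        rw [hp, vanishesAt_mk hE.homogeneous, ← eval_aeval_curve, hE.aeval_eq_zero, eval_zero]
      -- The tangent cone at p vanishes on all vectors of the tangent line, in particular at q.
      · refine absurd ?_ (hTq p (hfG.mem_toFinset.mpr ⟨hp.1, hpG⟩))
        rw [eval_tangentCone]
        exact hp.2.2 _ hlq
    · rintro ⟨hl, hlq⟩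
      refine ⟨?_, hlq⟩
      obtain ⟨t, hδ, hr, rfl⟩ := hgoodE l hl hlq
      rw [hrE, hrG, eval_mul, eval_mul, eval_mul] at hr
      have hr1 := left_ne_zero_of_mul hr
      have hγt : (fun i => (γ i).eval t) ≠ 0 := fun h =>
        right_ne_zero_of_mul hr1 (congrFun h 2)
      exact ⟨_, (hG.isTangentAt_mk_iff hγt hδ
        (left_ne_zero_of_mul (left_ne_zero_of_mul hr1)) _).mpr rfl⟩
  rw [hset]
  refine encard_line_section hE.homogeneous hq (fun v hv hvq hv1 hvE => ?_)
    (fun v hv hvq hvE => ?_)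
  · refine hYq (Projectivization.mk ℂ v hv) (hfY.mem_toFinset.mpr
      ⟨(vanishesAt_mk hE.homogeneous v hv).mpr hvE,
        (vanishesAt_mk (MvPolynomial.isHomogeneous_X ℂ 1) v hv).mpr ?_⟩) ?_
    · rw [MvPolynomial.eval_X, hv1]
    · rw [dotProduct_comm, dotProduct_rep_mk_eq_zero_iff, dotProduct_comm, hvq]
  · obtain ⟨t, hδ, hr, hmk⟩ := hgoodE (Projectivization.mk ℂ v hv)
      ((vanishesAt_mk hE.homogeneous v hv).mpr hvE)
      (by rw [dotProduct_comm, dotProduct_rep_mk_eq_zero_iff, dotProduct_comm, hvq])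
    rw [hrE, eval_mul, eval_mul] at hr
    have hB := right_ne_zero_of_mul hr
    have hγ2 := right_ne_zero_of_mul (left_ne_zero_of_mul hr)
    obtain ⟨c, hc⟩ := (Projectivization.mk_eq_mk_iff ℂ _ _ _ _).mp hmk
    rw [Units.smul_def] at hc
    have hgr : ∀ i, MvPolynomial.eval v (MvPolynomial.pderiv i E) = (c : ℂ) ^ (E.totalDegree - 1) *
        (MvPolynomial.aeval (dualCurve γ) (MvPolynomial.pderiv i E)).eval t := by
      intro i
      rw [← hc, (hE.homogeneous.pderiv (i := i)).eval_smul, eval_aeval_curve]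
    -- If the gradient of `E` were parallel to q, then q would be parallel to γ(t) and so lie on C.
    by_contra! hall
    apply hGq
    have hqv : q.rep = (q.rep 2 / (γ 2).eval t) • fun i => (γ i).eval t := by
      funext i
      have h1 := congrArg (eval t) (hE.gradient_dual hγ i 2)
      rw [eval_mul, eval_mul] at h1
      have h2 := hall i
      rw [hgr, hgr, mul_assoc, mul_assoc] at h2
      have h3 := mul_left_cancel₀ (pow_ne_zero _ c.ne_zero) h2
      have h4 := mul_left_cancel₀ hB (b := q.rep i * (γ 2).eval t)
        (c := q.rep 2 * (γ i).eval t) (by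
          linear_combination (-(γ 2).eval t) * h3 + q.rep 2 * h1)
      rw [Pi.smul_apply, smul_eq_mul, div_mul_eq_mul_div, ← h4, mul_div_cancel_right₀ _ hγ2]
    rw [hqv, hG.homogeneous.eval_smul, ← eval_aeval_curve, hG.aeval_eq_zero, eval_zero, mul_zero]

end Class

end

noncomputable section

/-! ### The linear correspondence between lines and foci -/

section LinearChange

open Polynomial

variable {k : Type} [Field k]

/-- The focus of the line with coordinates `δ` (the line `δ 0 * x + δ 1 * y + δ 2 = 0`). -/
def focusOfLine {R : Type*} [CommRing R] (δ : Fin 3 → R) : Fin 3 → R :=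
  ![δ 1, -δ 2, δ 0 + δ 1]

/-- The line with a given focus, the inverse of `focusOfLine`. -/
def lineOfFocus {R : Type*} [CommRing R] (φ : Fin 3 → R) : Fin 3 → R :=
  ![φ 2 - φ 0, φ 0, -φ 1]

theorem lineOfFocus_focusOfLine {R : Type*} [CommRing R] (δ : Fin 3 → R) :
    lineOfFocus (focusOfLine δ) = δ := by
  funext i
  fin_cases i <;> simp [lineOfFocus, focusOfLine]

theorem focusOfLine_lineOfFocus {R : Type*} [CommRing R] (φ : Fin 3 → R) :
    focusOfLine (lineOfFocus φ) = φ := by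
  funext i
  fin_cases i <;> simp [lineOfFocus, focusOfLine]

theorem map_focusOfLine {R S : Type*} [CommRing R] [CommRing S] (g : R →+* S) (δ : Fin 3 → R)
    (i : Fin 3) : g (focusOfLine δ i) = focusOfLine (fun j => g (δ j)) i := by
  fin_cases i <;> simp [focusOfLine]

theorem map_lineOfFocus {R S : Type*} [CommRing R] [CommRing S] (g : R →+* S) (φ : Fin 3 → R)
    (i : Fin 3) : g (lineOfFocus φ i) = lineOfFocus (fun j => g (φ j)) i := by
  fin_cases i <;> simp [lineOfFocus]

theorem focusOfLine_mul {R : Type*} [CommRing R] (c : R) (δ : Fin 3 → R) (i : Fin 3) :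
    focusOfLine (fun j => c * δ j) i = c * focusOfLine δ i := by
  fin_cases i <;> simp [focusOfLine, mul_add]

/-- The linear substitution turning forms on the dual plane into forms on the plane of foci. -/
def lineSubst : MvPolynomial (Fin 3) k →ₐ[k] MvPolynomial (Fin 3) k :=
  MvPolynomial.aeval (lineOfFocus MvPolynomial.X)

/-- The inverse of `lineSubst`. -/
def focusSubst : MvPolynomial (Fin 3) k →ₐ[k] MvPolynomial (Fin 3) k :=
  MvPolynomial.aeval (focusOfLine MvPolynomial.X)

theorem aeval_lineSubst {A : Type*} [CommRing A] [Algebra k A] (δ : Fin 3 → A)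
    (H : MvPolynomial (Fin 3) k) :
    MvPolynomial.aeval (focusOfLine δ) (lineSubst H) = MvPolynomial.aeval δ H := by
  have h : (MvPolynomial.aeval (focusOfLine δ)).comp (lineSubst (k := k)) =
      MvPolynomial.aeval δ := by
    refine MvPolynomial.algHom_ext fun i => ?_
    rw [AlgHom.comp_apply, lineSubst, MvPolynomial.aeval_X, MvPolynomial.aeval_X]
    refine (map_lineOfFocus (R := MvPolynomial (Fin 3) k)
      (MvPolynomial.aeval (R := k) (focusOfLine δ)).toRingHom _ i).trans ?_
    simp only [AlgHom.toRingHom_eq_coe, RingHom.coe_coe, MvPolynomial.aeval_X]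
    rw [lineOfFocus_focusOfLine]
  exact DFunLike.congr_fun h H

theorem aeval_focusSubst {A : Type*} [CommRing A] [Algebra k A] (δ : Fin 3 → A)
    (H : MvPolynomial (Fin 3) k) :
    MvPolynomial.aeval δ (focusSubst H) = MvPolynomial.aeval (focusOfLine δ) H := by
  have h : (MvPolynomial.aeval δ).comp (focusSubst (k := k)) =
      MvPolynomial.aeval (focusOfLine δ) := by
    refine MvPolynomial.algHom_ext fun i => ?_
    rw [AlgHom.comp_apply, focusSubst, MvPolynomial.aeval_X, MvPolynomial.aeval_X]
    refine (map_focusOfLine (R := MvPolynomial (Fin 3) k)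
      (MvPolynomial.aeval (R := k) δ).toRingHom _ i).trans ?_
    simp only [AlgHom.toRingHom_eq_coe, RingHom.coe_coe, MvPolynomial.aeval_X]
  exact DFunLike.congr_fun h H

theorem focusSubst_lineSubst (H : MvPolynomial (Fin 3) k) : focusSubst (lineSubst H) = H := by
  rw [focusSubst, aeval_lineSubst, MvPolynomial.aeval_X_left_apply]

theorem lineSubst_focusSubst (H : MvPolynomial (Fin 3) k) : lineSubst (focusSubst H) = H := by
  rw [lineSubst, aeval_focusSubst, focusOfLine_lineOfFocus, MvPolynomial.aeval_X_left_apply]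

theorem lineSubst_isHomogeneous {H : MvPolynomial (Fin 3) k} {n : ℕ} (hH : H.IsHomogeneous n) :
    (lineSubst H).IsHomogeneous n := by
  have h : ∀ i, (lineOfFocus (MvPolynomial.X (R := k)) i).IsHomogeneous 1 := by
    intro i
    have hX := MvPolynomial.isHomogeneous_X k (σ := Fin 3)
    fin_cases i
    · exact (hX 2).sub (hX 0)
    · exact hX 0
    · exact (hX 1).neg
  have := hH.aeval (lineOfFocus MvPolynomial.X) h
  rwa [one_mul] at this

/-- The equation of the focal curve obtained from the equation of the dual curve. -/
theorem IsEquation.focus {δ : Fin 3 → k[X]} {E : MvPolynomial (Fin 3) k} (hE : IsEquation δ E) :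
    IsEquation (focusOfLine δ) (lineSubst E) ∧ (lineSubst E).totalDegree = E.totalDegree := by
  have h0 : lineSubst E ≠ 0 := fun h => hE.ne_zero (by
    rw [← focusSubst_lineSubst E, h, map_zero])
  have hh := lineSubst_isHomogeneous hE.homogeneous
  have hd := hh.totalDegree h0
  refine ⟨⟨by rwa [hd], h0, fun H => ?_⟩, hd⟩
  have h1 : coneMap (focusOfLine δ) H = coneMap δ (focusSubst H) := by
    rw [coneMap, coneMap, aeval_focusSubst]
    congr 2
    funext i
    rw [focusOfLine_mul X (fun j => C (δ j)) i]
    congr 1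
    exact map_focusOfLine C δ i
  rw [h1, hE.coneMap_eq_zero_iff]
  refine ⟨fun h => ?_, fun h => ?_⟩
  · have := map_dvd lineSubst h
    rwa [lineSubst_focusSubst] at this
  · have := map_dvd focusSubst h
    rwa [focusSubst_lineSubst] at this

end LinearChange

/-! ### From parametrizations to real algebraic curves -/

section RealCurves

open Polynomial

theorem dualCurve_map (γ : Fin 3 → ℝ[X]) :
    dualCurve (fun i => (γ i).map (algebraMap ℝ ℂ)) =
      fun i => (dualCurve γ i).map (algebraMap ℝ ℂ) := by
  funext i
  fin_cases i <;> simp [dualCurve, wronskian, derivative_map]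

theorem wronskianDet_map (γ : Fin 3 → ℝ[X]) :
    wronskianDet (fun i => (γ i).map (algebraMap ℝ ℂ)) =
      (wronskianDet γ).map (algebraMap ℝ ℂ) := by
  simp only [wronskianDet, dualCurve_map, Polynomial.map_sum, Polynomial.map_mul, derivative_map]

/-- A real parametrized curve with an equation is an algebraic curve, provided that its
parametrization reaches all but finitely many points. -/
theorem IsEquation.isAlgebraicCurve {γ : Fin 3 → ℝ[X]} {F : MvPolynomial (Fin 3) ℝ}
    (hF : IsEquation γ F) {r : ℝ[X]} (hr : r ≠ 0)
    (hγ : ∀ t, r.eval t ≠ 0 → (fun i => (γ i).eval t) ≠ 0) {S : Set (ProjPlane ℝ)}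
    (hS : ∀ p, p ∈ S ↔ ∃ (t : ℝ) (h : (fun i => (γ i).eval t) ≠ 0),
      r.eval t ≠ 0 ∧ p = Projectivization.mk ℝ (fun i => (γ i).eval t) h)
    (hfin : {p : ProjPlane ℝ | VanishesAt F p ∧ ¬ ∃ (t : ℝ) (h : (fun i => (γ i).eval t) ≠ 0),
      r.eval t ≠ 0 ∧ p = Projectivization.mk ℝ (fun i => (γ i).eval t) h}.Finite) :
    IsAlgebraicCurve S F where
  homogeneous := hF.homogeneous
  irreducible := hF.map.prime.irreducible
  vanishing n G hG := by
    rw [hF.dvd_iff hG]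
    constructor
    · intro h
      -- Roots of `r` give no points of `S`; the factor `r` makes the product vanish there as well.
      have h0 : r * MvPolynomial.aeval γ G = 0 := by
        refine Polynomial.funext fun t => ?_
        rw [eval_mul, eval_zero, eval_aeval_curve]
        by_cases ht : r.eval t = 0
        · rw [ht, zero_mul]
        · have := h _ ((hS _).mpr ⟨t, hγ t ht, ht, rfl⟩)
          rw [vanishesAt_mk hG] at this
          rw [this, mul_zero]
      exact (mul_eq_zero.mp h0).resolve_left hr
    · intro h p hp
      obtain ⟨t, ht, -, rfl⟩ := (hS p).mp hp
      rw [vanishesAt_mk hG, ← eval_aeval_curve, h, eval_zero]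
  finite_missing := hfin.subset fun p hp => ⟨hp.1, fun h => hp.2 ((hS p).mpr h)⟩

end RealCurves

/-! ### The graph and focal curve of a rational function -/

section RationalFunctions

open Polynomial

/-- For nonconstant a and b, the coefficient of the Wronskian in degree deg a + deg b - 1 is (deg b
- deg a) times the product of the leading coefficients. -/
theorem natDegree_eq_of_wronskian_eq_zero {k : Type*} [Field k] [CharZero k] {a b : k[X]}
    (ha : a ≠ 0) (hb : b ≠ 0) (h : wronskian a b = 0) : a.natDegree = b.natDegree := by
  rw [wronskian, sub_eq_zero] at h
  rcases Nat.eq_zero_or_pos a.natDegree with ha0 | ha0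
  · rw [derivative_of_natDegree_zero ha0, zero_mul, mul_eq_zero, or_iff_right ha] at h
    rw [ha0, derivative_eq_zero.mp h]
  rcases Nat.eq_zero_or_pos b.natDegree with hb0 | hb0
  · rw [derivative_of_natDegree_zero hb0, mul_zero, eq_comm, mul_eq_zero, or_iff_left hb] at h
    rw [hb0, derivative_eq_zero.mp h]
  have h1 := congrArg (fun p => p.coeff (a.natDegree + (b.natDegree - 1))) h
  rw [coeff_mul_add_eq_of_natDegree_le le_rfl (natDegree_derivative_le b),
    show a.natDegree + (b.natDegree - 1) = (a.natDegree - 1) + b.natDegree by omega,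
    coeff_mul_add_eq_of_natDegree_le (natDegree_derivative_le a) le_rfl, coeff_derivative,
    coeff_derivative, Nat.sub_add_cancel ha0, Nat.sub_add_cancel hb0] at h1
  have h2 : a.leadingCoeff * b.leadingCoeff * ((a.natDegree : k) - b.natDegree) = 0 := by
    have e1 : ((a.natDegree - 1 : ℕ) : k) + 1 = a.natDegree := by
      rw [← Nat.cast_succ, Nat.succ_eq_add_one, Nat.sub_add_cancel ha0]
    have e2 : ((b.natDegree - 1 : ℕ) : k) + 1 = b.natDegree := by
      rw [← Nat.cast_succ, Nat.succ_eq_add_one, Nat.sub_add_cancel hb0]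
    rw [e1, e2] at h1
    simp only [leadingCoeff]
    linear_combination -h1
  rw [mul_eq_zero, or_iff_right (mul_ne_zero (leadingCoeff_ne_zero.mpr ha)
    (leadingCoeff_ne_zero.mpr hb)), sub_eq_zero, Nat.cast_inj] at h2
  exact h2

/-- In characteristic zero, polynomials with vanishing Wronskian are proportional. -/
theorem exists_eq_C_mul_of_wronskian_eq_zero {k : Type*} [Field k] [CharZero k] {a b : k[X]}
    (hb : b ≠ 0) (h : wronskian a b = 0) : ∃ c, a = C c * b := by
  by_cases ha : a = 0
  · exact ⟨0, by rw [ha, C_0, zero_mul]⟩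
  have hdeg := natDegree_eq_of_wronskian_eq_zero ha hb h
  have hlb := leadingCoeff_ne_zero.mpr hb
  have hla := leadingCoeff_ne_zero.mpr ha
  set c := a.leadingCoeff / b.leadingCoeff with hc
  have hc0 : c ≠ 0 := div_ne_zero hla hlb
  refine ⟨c, ?_⟩
  by_contra hne
  have hd : a - C c * b ≠ 0 := sub_ne_zero.mpr hne
  have hdb : (C c * b).natDegree = b.natDegree := natDegree_C_mul hc0
  have hcb : C c * b ≠ 0 := mul_ne_zero (C_ne_zero.mpr hc0) hb
  have hlt : (a - C c * b).degree < a.degree := by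
    refine degree_sub_lt_left ?_ ha ?_
    · rw [degree_eq_natDegree ha, degree_eq_natDegree hcb, hdb, hdeg]
    · rw [leadingCoeff_mul, leadingCoeff_C, hc, div_mul_cancel₀ _ hlb]
  have hw : wronskian (a - C c * b) b = 0 := by
    rw [wronskian] at h ⊢
    simp only [derivative_sub, derivative_mul, derivative_C]
    linear_combination h
  have := natDegree_eq_of_wronskian_eq_zero hd hb hw
  rw [degree_eq_natDegree hd, degree_eq_natDegree ha, this, hdeg] at hlt
  exact lt_irrefl _ hlt

/-- The polynomial parametrization of the graph of a rational function. -/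
def graphParam (f : RatFunc ℝ) : Fin 3 → ℝ[X] := ![X * f.denom, f.num, f.denom]

/-- With w = PQ' - P'Q one has f' = -w/Q², and Q times the determinant is the Wronskian of w and Q².
Its vanishing makes f' constant, and a second integration makes f affine. -/
theorem wronskianDet_graphParam_ne_zero {f : RatFunc ℝ}
    (hf : ∀ a b : ℝ, f ≠ RatFunc.C a * RatFunc.X + RatFunc.C b) :
    wronskianDet (graphParam f) ≠ 0 := by
  intro h
  have hQ := f.denom_ne_zero
  have h1 : wronskian (wronskian f.num f.denom) (f.denom ^ 2) = 0 := by
    rw [← mul_zero f.denom, ← h]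
    simp only [wronskianDet, graphParam, dualCurve, wronskian, Fin.sum_univ_three, Matrix.cons_val,
      derivative_sub, derivative_mul, derivative_add, derivative_X, derivative_pow, derivative_one]
    push_cast
    simp only [map_ofNat]
    ring
  obtain ⟨c, hc⟩ := exists_eq_C_mul_of_wronskian_eq_zero (pow_ne_zero 2 hQ) h1
  have h2 : wronskian (f.num + C c * X * f.denom) f.denom = 0 := by
    rw [wronskian] at hc ⊢
    simp only [derivative_add, derivative_mul, derivative_C, derivative_X]
    linear_combination hc
  obtain ⟨b, hb⟩ := exists_eq_C_mul_of_wronskian_eq_zero hQ h2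
  apply hf (-c) b
  have h3 : f.num = (C (-c) * X + C b) * f.denom := by
    rw [C_neg]
    linear_combination hb
  have hQ' : algebraMap ℝ[X] (RatFunc ℝ) f.denom ≠ 0 := RatFunc.algebraMap_ne_zero hQ
  conv_lhs => rw [← RatFunc.num_div_denom f, h3, map_mul, mul_div_cancel_right₀ _ hQ']
  simp

theorem ratFun_eq (f : RatFunc ℝ) : ratFun f = fun x => f.num.eval x / f.denom.eval x := by
  funext x
  rw [ratFun, RatFunc.eval]
  rfl

theorem deriv_ratFun {f : RatFunc ℝ} {t : ℝ} (ht : f.denom.eval t ≠ 0) :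
    deriv (ratFun f) t = ((derivative f.num).eval t * f.denom.eval t -
      f.num.eval t * (derivative f.denom).eval t) / f.denom.eval t ^ 2 := by
  rw [ratFun_eq]
  exact ((f.num.hasDerivAt t).fun_div (f.denom.hasDerivAt t) ht).deriv

theorem mem_graphCurve_iff (f : RatFunc ℝ) (p : ProjPlane ℝ) :
    p ∈ graphCurve f ↔ ∃ (t : ℝ) (h : (fun i => (graphParam f i).eval t) ≠ 0),
      f.denom.eval t ≠ 0 ∧ p = Projectivization.mk ℝ (fun i => (graphParam f i).eval t) h := by
  have key : ∀ t, f.denom.eval t ≠ 0 → ∀ h : (fun i => (graphParam f i).eval t) ≠ 0,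
      affinePoint t (ratFun f t) =
        Projectivization.mk ℝ (fun i => (graphParam f i).eval t) h := by
    intro t ht h
    refine mk_eq_mk_of_cross _ h fun i j => ?_
    simp only [ratFun_eq, graphParam]
    fin_cases i <;> fin_cases j <;> simp <;> field_simp
  constructor
  · rintro ⟨t, ht, rfl⟩
    have h : (fun i => (graphParam f i).eval t) ≠ 0 := fun h => ht (congrFun h 2)
    exact ⟨t, h, ht, key t ht h⟩
  · rintro ⟨t, h, ht, rfl⟩
    exact ⟨t, ht, (key t ht h).symm⟩

theorem eval_focusOfLine_dualCurve_graphParam_zero (f : RatFunc ℝ) (t : ℝ) :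
    (focusOfLine (dualCurve (graphParam f)) 0).eval t = f.denom.eval t ^ 2 := by
  simp [focusOfLine, dualCurve, graphParam, wronskian]
  ring

theorem mem_focalCurve_iff (f : RatFunc ℝ) (p : ProjPlane ℝ) :
    p ∈ focalCurve f ↔
      ∃ (t : ℝ) (h : (fun i => (focusOfLine (dualCurve (graphParam f)) i).eval t) ≠ 0),
        f.denom.eval t ≠ 0 ∧ p = Projectivization.mk ℝ
          (fun i => (focusOfLine (dualCurve (graphParam f)) i).eval t) h := by
  have key : ∀ t, f.denom.eval t ≠ 0 →
      ∀ h : (fun i => (focusOfLine (dualCurve (graphParam f)) i).eval t) ≠ 0,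
      localFocus (ratFun f) t = Projectivization.mk ℝ
        (fun i => (focusOfLine (dualCurve (graphParam f)) i).eval t) h := by
    intro t ht h
    rw [localFocus, linearFocus, eq_comm, Projectivization.mk_eq_mk_iff']
    refine ⟨f.denom.eval t ^ 2, ?_⟩
    rw [deriv_ratFun ht, ratFun_eq]
    funext i
    fin_cases i
    · simp only [Fin.zero_eta, eval_focusOfLine_dualCurve_graphParam_zero]
      simp
    · simp [focusOfLine, dualCurve, graphParam, wronskian]
      field_simp
      ring
    · simp [focusOfLine, dualCurve, graphParam, wronskian]
      field_simp
      ring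
  constructor
  · rintro ⟨t, ht, rfl⟩
    have h : (fun i => (focusOfLine (dualCurve (graphParam f)) i).eval t) ≠ 0 := fun h => by
      have := congrFun h 0
      simp only [eval_focusOfLine_dualCurve_graphParam_zero] at this
      exact pow_ne_zero 2 ht this
    exact ⟨t, h, ht, key t ht h⟩
  · rintro ⟨t, h, ht, rfl⟩
    exact ⟨t, ht, (key t ht h).symm⟩

/-- No two coordinates of the focal curve of a nondegenerate curve are proportional. -/
theorem wronskian_focusOfLine_ne_zero {k : Type} [Field k] {γ : Fin 3 → k[X]}
    (hγ : wronskianDet γ ≠ 0) (i j : Fin 3) (hij : i ≠ j) :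
    wronskian (focusOfLine (dualCurve γ) i) (focusOfLine (dualCurve γ) j) ≠ 0 := by
  refine wronskian_ne_zero_of_dualCurve_ne_zero (fun m => ?_) i j hij
  have h0 := dualCurve_dualCurve γ 0
  have h1 := dualCurve_dualCurve γ 1
  have h2 := dualCurve_dualCurve γ 2
  set δ := dualCurve γ with hδ
  have hne := apply_ne_zero_of_wronskianDet_ne_zero hγ
  simp only [dualCurve, wronskian, Matrix.cons_val] at h0 h1 h2
  have h01 : γ 1 - γ 0 ≠ 0 := by
    intro h
    apply hγ
    rw [sub_eq_zero] at h
    simp only [wronskianDet, dualCurve, wronskian, Fin.sum_univ_three, Matrix.cons_val, h]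
    ring
  -- A linear change of δ acts contragrediently on δ × δ' = Wγ, giving W(γ₀ - γ₁, γ₂, -γ₀).
  have e0 : dualCurve (focusOfLine δ) 0 = wronskianDet γ * (γ 0 - γ 1) := by
    simp only [dualCurve, focusOfLine, wronskian, Matrix.cons_val, derivative_add, derivative_neg]
    linear_combination h0 - h1
  have e1 : dualCurve (focusOfLine δ) 1 = wronskianDet γ * γ 2 := by
    simp only [dualCurve, focusOfLine, wronskian, Matrix.cons_val, derivative_add, derivative_neg]
    linear_combination h2
  have e2 : dualCurve (focusOfLine δ) 2 = wronskianDet γ * (-γ 0) := by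
    simp only [dualCurve, focusOfLine, wronskian, Matrix.cons_val, derivative_add, derivative_neg]
    linear_combination -h0
  fin_cases m
  · simp only [Fin.zero_eta, e0]
    exact mul_ne_zero hγ (sub_ne_zero.mpr (sub_ne_zero.mp h01).symm)
  · simp only [Fin.mk_one, e1]
    exact mul_ne_zero hγ (hne 2)
  · simp only [Fin.reduceFinMk, e2]
    exact mul_ne_zero hγ (neg_ne_zero.mpr (hne 0))

end RationalFunctions

end

theorem mainTheorem3 (f : RatFunc ℝ)
    (hf : ∀ a b : ℝ, f ≠ RatFunc.C a * RatFunc.X + RatFunc.C b) :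
    ∃ G F : MvPolynomial (Fin 3) ℝ,
      IsAlgebraicCurve (graphCurve f) G ∧
      IsAlgebraicCurve (focalCurve f) F ∧
      HasClass (MvPolynomial.map (algebraMap ℝ ℂ) G) F.totalDegree := by
  have hγ := wronskianDet_graphParam_ne_zero hf
  have hQ := f.denom_ne_zero
  have hX : graphParam f 0 = Polynomial.X * graphParam f 2 := rfl
  obtain ⟨G, hG⟩ := exists_isEquation
    (wronskian_ne_zero_of_dualCurve_ne_zero (dualCurve_ne_zero hγ))
  obtain ⟨E, hE⟩ := exists_isEquation
    (wronskian_ne_zero_of_dualCurve_ne_zero (dualCurve_dualCurve_ne_zero hγ))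
  obtain ⟨hF, hdeg⟩ := hE.focus
  refine ⟨G, lineSubst E, ?_, ?_, ?_⟩
  · exact hG.isAlgebraicCurve hQ (fun t ht h => ht (congrFun h 2)) (mem_graphCurve_iff f)
      (hG.finite_diff_range_self hγ hX hQ)
  -- The parameter is again ∂₀E/∂₂E, carried to the plane of foci by the linear substitution.
  · refine hF.isAlgebraicCurve hQ (fun t ht h => ?_) (mem_focalCurve_iff f)
      (hF.finite_diff_range (wronskian_focusOfLine_ne_zero hγ)
        (lineSubst_isHomogeneous (hE.homogeneous.pderiv (i := 0)))
        (lineSubst_isHomogeneous (hE.homogeneous.pderiv (i := 2))) ?_ ?_ hQ)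
    · have := congrFun h 0
      simp only [eval_focusOfLine_dualCurve_graphParam_zero] at this
      exact pow_ne_zero 2 ht this
    · rw [aeval_lineSubst, aeval_lineSubst]
      have h := hE.gradient_dual hγ 0 2
      rw [hX] at h
      apply mul_right_cancel₀ (apply_ne_zero_of_wronskianDet_ne_zero hγ 2)
      linear_combination h
    · rw [aeval_lineSubst]
      exact hE.aeval_pderiv_dual_ne_zero hγ 2
  · have hEC := hE.map
    rw [← dualCurve_map] at hEC
    have hγC : wronskianDet (fun i => (graphParam f i).map (algebraMap ℝ ℂ)) ≠ 0 := by
      rw [wronskianDet_map, Polynomial.map_ne_zero_iff (algebraMap ℝ ℂ).injective]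
      exact hγ
    have h := hasClass_of_isEquation_dualCurve hγC (by
      rw [hX, Polynomial.map_mul, Polynomial.map_X]) hG.map hEC
    rwa [(hE.homogeneous.map (algebraMap ℝ ℂ)).totalDegree hEC.ne_zero, ← hdeg] at h
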